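/- All graphs are finite, undirected and simple. For a field $\mathbb{F}$ and a graph $G$ on the vertex set $[n]$, a matrix $A \in \mathbb{F}^{n\times n}$ represents $G$ if $A_{i,i}\neq 0$ for every $i$, and $A_{i,j}=0$ for every two distinct non-adjacent vertices $i,j$; let $\mathrm{minrk}_{\mathbb{F}}(G)$ be the smallest rank of a matrix over $\mathbb{F}$ that represents $G$. Let $\mathrm{DMR}_{\mathbb{F}}$ be the parameterized problem that, given a graph $G$ on $n$ vertices and an integer $k\ge 0$ (the parameter), asks whether $\mathrm{minrk}_{\mathbb{F}}(G)\le n-k$. A kernelization algorithm for a parameterized graph problem is an algorithm that on every instance $(G,k)$ runs in time polynomial in the bit size of $(G,k)$ and returns an instance $(G',k')$ such that $(G,k)$ is a YES instance if and only if $(G',k')$ is, and such that the bit size of $G'$ and the integer $k'$ are at most $h(k)$ for some computable function $h:\mathbb{N}\to\mathbb{N}$. Theorem. For every field $\mathbb{F}$, there exists a kernelization algorithm for $\mathrm{DMR}_{\mathbb{F}}$ which, given an instance $(G,k)$, returns an equivalent instance $(G',k')$ with $k'\le k$, where $G'$ has at most $\max(3k'-3,0)$ vertices. -/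

import Mathlib

/-! ### Minrank -/

section Minrank

variable {V : Type*} [Fintype V] (F : Type*) [Field F]

/-- The matrix `A` represents the graph `G` over `F`: its diagonal entries are nonzero, and its
entries at pairs of distinct nonadjacent vertices are zero. -/
def RepresentsGraph {F : Type*} [Field F] (A : Matrix V V F) (G : SimpleGraph V) : Prop :=
  (∀ i, A i i ≠ 0) ∧ ∀ i j, i ≠ j → ¬ G.Adj i j → A i j = 0

/-- The minrank of `G` over `F`: the least rank of a matrix that represents `G` over `F`. -/
noncomputable def minrank (G : SimpleGraph V) : ℕ :=
  sInf {r | ∃ A : Matrix V V F, RepresentsGraph A G ∧ A.rank = r}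

/-- The minimum in the definition of minrank is attained. -/
theorem exists_rank_eq_minrank (G : SimpleGraph V) :
    ∃ A : Matrix V V F, RepresentsGraph A G ∧ A.rank = minrank F G := by
  classical
  exact Nat.sInf_mem (s := {r | ∃ A : Matrix V V F, RepresentsGraph A G ∧ A.rank = r})
    ⟨_, 1, ⟨fun i => by simp, fun i j h _ => by simp [h]⟩, rfl⟩

end Minrank

/-! ### Parameterized graph problems -/

/-- An instance `(G, k)` of a parameterized graph problem: a finite simple graph on the vertices
`0, …, n - 1` and a parameter `k ≥ 0`. -/
structure GraphInstance where
  n : ℕ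
  graph : SimpleGraph (Fin n)
  k : ℕ

/-- The number of bits used to write down an instance: the adjacency matrix of the graph and the
binary expansion of the parameter. -/
def GraphInstance.size (I : GraphInstance) : ℕ := I.n ^ 2 + Nat.size I.k

/-- The Dual Minrank problem over `F`, as the set of its YES instances: those `(G, k)` with
`minrank F G ≤ n - k`, where `n` is the number of vertices of `G` (subtraction of integers). -/
def dualMinrank (F : Type*) [Field F] : Set GraphInstance :=
  {I | (minrank F I.graph : ℤ) ≤ (I.n : ℤ) - (I.k : ℤ)}

/-! ### Random access machines

The machine model is the unit-cost random access machine with addition and (truncated) subtraction.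
A program uses registers, each of which holds a natural number, and memory cells, which are
addressed indirectly, through the contents of a register. The memory is divided into banks
(arrays); the bank that an instruction accesses is written in the program, so that each program
uses only finitely many banks and registers.

In `t` steps the largest number in the machine can grow by at most `t + O(1)` bits, since
there is no multiplication; so polynomial time on this machine is polynomial time on
Turing machines. -/

/-- Programs. In the comments `R x` is register `x` and `M b a` is the cell with address `a`
of the memory bank `b`. -/
inductive RAMProgram where
  /-- `R x := c` -/
  | const (x c : ℕ)
  /-- `R x := R y + R z` -/
  | add (x y z : ℕ)
  /-- `R x := max (R y - R z) 0` -/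
  | sub (x y z : ℕ)
  /-- `R x := M b (R y)` -/
  | load (x b y : ℕ)
  /-- `M b (R y) := R x` -/
  | store (b y x : ℕ)
  /-- first `P`, then `Q` -/
  | seq (P Q : RAMProgram)
  /-- `P` if `R x ≠ 0`, and `Q` otherwise -/
  | ite (x : ℕ) (P Q : RAMProgram)
  /-- repeat `P` as long as `R x ≠ 0` -/
  | while (x : ℕ) (P : RAMProgram)

/-- A state of the machine: the contents of the registers and of the memory banks. -/
structure RAMState where
  reg : ℕ → ℕ
  mem : ℕ → ℕ → ℕ

namespace RAMState

def setReg (s : RAMState) (x v : ℕ) : RAMState :=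
  { s with reg := Function.update s.reg x v }

def setMem (s : RAMState) (b a v : ℕ) : RAMState :=
  { s with mem := Function.update s.mem b (Function.update (s.mem b) a v) }

open Classical in
/-- The initial state for the input `(G, k)`: register `0` holds the number `n` of vertices,
register `1` holds `k`, and the cell `i * n + j` of bank `0` holds the entry `(i, j)` of the
adjacency matrix of `G`. All the other registers and cells hold `0`. -/
noncomputable def init (I : GraphInstance) : RAMState where
  reg x := if x = 0 then I.n else if x = 1 then I.k else 0
  mem b a := if b = 0 ∧ ∃ i j : Fin I.n, I.graph.Adj i j ∧ a = i * I.n + j then 1 else 0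

open Classical in
/-- The output that is read off from the state `s` is the instance `I`, written in the same format
as the input; the contents of all the other registers and cells are ignored. -/
def Outputs (s : RAMState) (I : GraphInstance) : Prop :=
  s.reg 0 = I.n ∧ s.reg 1 = I.k ∧
    ∀ i j : Fin I.n, s.mem 0 (i * I.n + j) = if I.graph.Adj i j then 1 else 0

end RAMState

namespace RAMProgram

/-- `P.Runs s t s'`: started in the state `s`, the program `P` halts after exactly `t` steps in the
state `s'`. Every assignment and every test takes one step. -/
inductive Runs : RAMProgram → RAMState → ℕ → RAMState → Prop where
  | const (s : RAMState) (x c : ℕ) : Runs (const x c) s 1 (s.setReg x c)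
  | add (s : RAMState) (x y z : ℕ) : Runs (add x y z) s 1 (s.setReg x (s.reg y + s.reg z))
  | sub (s : RAMState) (x y z : ℕ) : Runs (sub x y z) s 1 (s.setReg x (s.reg y - s.reg z))
  | load (s : RAMState) (x b y : ℕ) : Runs (load x b y) s 1 (s.setReg x (s.mem b (s.reg y)))
  | store (s : RAMState) (b y x : ℕ) : Runs (store b y x) s 1 (s.setMem b (s.reg y) (s.reg x))
  | seq {P Q : RAMProgram} {s₁ s₂ s₃ : RAMState} {t u : ℕ} :
      Runs P s₁ t s₂ → Runs Q s₂ u s₃ → Runs (seq P Q) s₁ (t + u) s₃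
  | ite_true {x : ℕ} {P Q : RAMProgram} {s s' : RAMState} {t : ℕ} :
      s.reg x ≠ 0 → Runs P s t s' → Runs (ite x P Q) s (t + 1) s'
  | ite_false {x : ℕ} {P Q : RAMProgram} {s s' : RAMState} {t : ℕ} :
      s.reg x = 0 → Runs Q s t s' → Runs (ite x P Q) s (t + 1) s'
  | while_true {x : ℕ} {P : RAMProgram} {s₁ s₂ s₃ : RAMState} {t u : ℕ} :
      s₁.reg x ≠ 0 → Runs P s₁ t s₂ → Runs (.while x P) s₂ u s₃ →
        Runs (.while x P) s₁ (t + u + 1) s₃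
  | while_false {x : ℕ} {P : RAMProgram} {s : RAMState} :
      s.reg x = 0 → Runs (.while x P) s 1 s

/-- On every input `I` the program `P` halts with the output `f I`, after a number of steps that is
bounded by a polynomial in the size of `I`. -/
def ComputesInPolyTime (P : RAMProgram) (f : GraphInstance → GraphInstance) : Prop :=
  ∃ p : Polynomial ℕ, ∀ I : GraphInstance, ∃ (t : ℕ) (s : RAMState),
    t ≤ p.eval I.size ∧ P.Runs (RAMState.init I) t s ∧ s.Outputs (f I)

end RAMProgram

/-! ### Kernelization -/

/-- The program `P` is a (polynomial-time) kernelization algorithm for the parameterized graph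
problem `L`, and `f` is the map from instances to instances that it computes. -/
structure IsKernelization (L : Set GraphInstance) (P : RAMProgram)
    (f : GraphInstance → GraphInstance) : Prop where
  /-- The algorithm runs in polynomial time. -/
  polyTime : P.ComputesInPolyTime f
  /-- The size and the parameter of the kernel are bounded by a computable function of `k`. -/
  bounded : ∃ h : ℕ → ℕ, Computable h ∧ ∀ I, (f I).size ≤ h I.k ∧ (f I).k ≤ h I.k
  /-- The kernel is equivalent to the given instance. -/
  equiv : ∀ I, I ∈ L ↔ f I ∈ L

/-! ### Minrank and crowns -/

section CrownMinrank

variable {V W : Type*} [Fintype V] [Fintype W] {F : Type*} [Field F]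

theorem rank_add_finrank_ker (A : Matrix V V F) :
    A.rank + Module.finrank F (LinearMap.ker A.mulVecLin) = Fintype.card V := by
  have := LinearMap.finrank_range_add_finrank_ker A.mulVecLin
  simpa [Matrix.rank] using this

theorem rank_fromBlocks_diagonal [DecidableEq V] (d : V → F) (hd : ∀ i, d i ≠ 0)
    (B : Matrix W W F) :
    (Matrix.fromBlocks (Matrix.diagonal d) 0 0 B).rank = Fintype.card V + B.rank := by
  have h1 := rank_add_finrank_ker (Matrix.fromBlocks (Matrix.diagonal d) 0 0 B)
  have h2 := rank_add_finrank_ker B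
  have key : ∀ x : V ⊕ W → F, x ∈ LinearMap.ker
      (Matrix.fromBlocks (Matrix.diagonal d) 0 0 B).mulVecLin ↔
      (∀ i, x (Sum.inl i) = 0) ∧ (x ∘ Sum.inr) ∈ LinearMap.ker B.mulVecLin := by
    intro x
    rw [LinearMap.mem_ker, LinearMap.mem_ker, Matrix.mulVecLin_apply, Matrix.mulVecLin_apply,
      Matrix.fromBlocks_mulVec]
    constructor
    · intro h
      refine ⟨fun i => ?_, funext fun j => ?_⟩
      · have := congrFun h (Sum.inl i)
        simpa [Matrix.mulVec_diagonal, hd i] using this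
      · have := congrFun h (Sum.inr j)
        simpa using this
    · rintro ⟨h, h'⟩
      funext j
      rcases j with i | j
      · simp [Matrix.mulVec_diagonal, h]
      · simpa using congrFun h' j
  let e : LinearMap.ker (Matrix.fromBlocks (Matrix.diagonal d) 0 0 B).mulVecLin ≃ₗ[F]
      LinearMap.ker B.mulVecLin :=
    { toFun := fun x => ⟨x.1 ∘ Sum.inr, ((key x.1).1 x.2).2⟩
      map_add' := fun x y => rfl
      map_smul' := fun a x => rfl
      invFun := fun y => ⟨Sum.elim 0 y.1, (key _).2 ⟨fun i => rfl, y.2⟩⟩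
      left_inv := by
        rintro ⟨x, hx⟩
        ext j
        rcases j with i | j
        · simpa using (((key x).1 hx).1 i).symm
        · rfl
      right_inv := fun y => rfl }
  have h3 := e.finrank_eq
  rw [Fintype.card_sum] at h1
  omega

theorem minrank_le_rank {G : SimpleGraph V} {A : Matrix V V F} (h : RepresentsGraph A G) :
    minrank F G ≤ A.rank :=
  Nat.sInf_le ⟨A, h, rfl⟩

variable (F) in
theorem minrank_le_card (G : SimpleGraph V) : minrank F G ≤ Fintype.card V := by
  obtain ⟨A, -, hA⟩ := exists_rank_eq_minrank F G
  exact hA ▸ Matrix.rank_le_card_width A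

variable (F) in
/-- If the vertices outside the range of `L` lie in `I ∪ H`, and `H` is matched into `I`, then the
minrank exceeds the minrank of the graph induced by `L` by at most `I.card`. -/
theorem minrank_le_comap_add_card (G : SimpleGraph V) (L : W → V) (I H : Finset V) (g : V → V)
    (hcov : ∀ v, v ∈ I ∨ v ∈ H ∨ v ∈ Set.range L)
    (hgI : ∀ v ∈ H, g v ∈ I) (hadj : ∀ v ∈ H, G.Adj v (g v)) (hinj : Set.InjOn g H) :
    minrank F G ≤ minrank F (G.comap L) + I.card := by
  classical
  obtain ⟨B, hB, hBr⟩ := exists_rank_eq_minrank F (G.comap L)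
  have hc : ∀ v, ∃ c : I ⊕ W, (∃ w, c = Sum.inr w ∧ L w = v) ∨
      (∃ i : I, c = Sum.inl i ∧ (v = i ∨ v ∈ H ∧ g v = i)) := by
    intro v
    rcases hcov v with h | h | ⟨w, h⟩
    · exact ⟨Sum.inl ⟨v, h⟩, Or.inr ⟨_, rfl, Or.inl rfl⟩⟩
    · exact ⟨Sum.inl ⟨g v, hgI v h⟩, Or.inr ⟨_, rfl, Or.inr ⟨h, rfl⟩⟩⟩
    · exact ⟨Sum.inr w, Or.inl ⟨w, rfl, h⟩⟩
  choose c hc using hc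
  let M : Matrix (I ⊕ W) (I ⊕ W) F := Matrix.fromBlocks (Matrix.diagonal fun _ => 1) 0 0 B
  have hM : M.rank = I.card + B.rank := by
    rw [rank_fromBlocks_diagonal _ (fun _ => one_ne_zero), Fintype.card_coe]
  have hrep : RepresentsGraph (M.submatrix c c) G := by
    constructor
    · intro v
      rcases hc v with ⟨w, h, -⟩ | ⟨i, h, -⟩
      · simpa [M, h] using hB.1 w
      · simp [M, h]
    · intro v v' hne hna
      rcases hc v with ⟨w, h, hw⟩ | ⟨i, h, hi⟩ <;> rcases hc v' with ⟨w', h', hw'⟩ | ⟨i', h', hi'⟩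
      · simp only [M, h, h', Matrix.submatrix_apply, Matrix.fromBlocks_apply₂₂]
        refine hB.2 w w' ?_ ?_
        · rintro rfl; exact hne (hw ▸ hw')
        · simpa [hw, hw'] using hna
      · simp [M, h, h']
      · simp [M, h, h']
      · simp only [M, h, h', Matrix.submatrix_apply, Matrix.fromBlocks_apply₁₁]
        refine Matrix.diagonal_apply_ne _ ?_
        rintro rfl
        rcases hi with hi | ⟨hi, hi2⟩ <;> rcases hi' with hi' | ⟨hi', hi2'⟩
        · exact hne (hi.trans hi'.symm)
        · exact hna (by rw [hi, ← hi2']; exact (hadj v' hi').symm)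
        · exact hna (by rw [hi', ← hi2]; exact hadj v hi)
        · exact hne (hinj hi hi' (hi2.trans hi2'.symm))
  have h1 := minrank_le_rank hrep
  have h2 := Matrix.rank_submatrix_le M c c
  omega

variable (F) in
/-- If `I` is independent, and has neither members nor neighbors in the range of `L`, then the
minrank exceeds the minrank of the graph induced by `L` by at least `I.card`. -/
theorem comap_add_card_le_minrank (G : SimpleGraph V) (L : W → V) (hL : Function.Injective L)
    (I : Finset V) (hI : ∀ v ∈ I, ∀ w ∈ I, ¬ G.Adj v w) (hLI : ∀ w, L w ∉ I)
    (hadj : ∀ v ∈ I, ∀ w, ¬ G.Adj v (L w)) :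
    minrank F (G.comap L) + I.card ≤ minrank F G := by
  classical
  obtain ⟨A, hA, hAr⟩ := exists_rank_eq_minrank F G
  let e : I ⊕ W → V := Sum.elim Subtype.val L
  have hrep : RepresentsGraph (A.submatrix L L) (G.comap L) :=
    ⟨fun i => hA.1 _, fun i j hij hn => hA.2 _ _ (hL.ne hij) (by simpa using hn)⟩
  have hblock : A.submatrix e e = Matrix.fromBlocks
      (Matrix.diagonal fun i : I => A i i) 0 0 (A.submatrix L L) := by
    ext x y
    rcases x with i | w <;> rcases y with j | w'
    · by_cases hij : i = j
      · subst hij; simp [e]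
      · simp only [e, Matrix.submatrix_apply, Sum.elim_inl, Matrix.fromBlocks_apply₁₁]
        rw [Matrix.diagonal_apply_ne _ hij]
        exact hA.2 _ _ (fun h => hij (Subtype.ext h)) (hI _ i.2 _ j.2)
    · exact hA.2 _ _ (fun h => hLI w' (by rw [← show (i : V) = L w' from h]; exact i.2))
        (hadj _ i.2 _)
    · exact hA.2 _ _ (fun h => hLI w (by rw [show L w = (j : V) from h]; exact j.2))
        (fun h => hadj _ j.2 _ h.symm)
    · rfl
  have h1 := Matrix.rank_submatrix_le A e e
  rw [hblock, rank_fromBlocks_diagonal _ (fun i => hA.1 _), Fintype.card_coe] at h1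
  have h2 := minrank_le_rank hrep
  omega

variable (F) in
theorem minrank_add_card_le_of_matching (G : SimpleGraph V) (S : Finset V) (g : V → V)
    (hgS : ∀ v ∈ S, g v ∉ S) (hadj : ∀ v ∈ S, G.Adj v (g v)) (hinj : Set.InjOn g S) :
    minrank F G + S.card ≤ Fintype.card V := by
  classical
  have h := minrank_le_comap_add_card F G (fun w : Empty => w.elim) Sᶜ S g
    (fun v => by by_cases h : v ∈ S <;> simp [h]) (fun v hv => by simpa using hgS v hv) hadj hinj
  have h0 := minrank_le_card F (G.comap (fun w : Empty => (w.elim : V)))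
  have h1 := Finset.card_add_card_compl S
  simp only [Fintype.card_empty] at h0
  omega

end CrownMinrank

/-! ### Weakest preconditions for random access machines -/

namespace RAMState

theorem reg_setReg (s : RAMState) (x v y : ℕ) :
    (s.setReg x v).reg y = if y = x then v else s.reg y := Function.update_apply ..

theorem mem_setReg (s : RAMState) (x v : ℕ) : (s.setReg x v).mem = s.mem := rfl

theorem reg_setMem (s : RAMState) (b a v : ℕ) : (s.setMem b a v).reg = s.reg := rfl

theorem mem_setMem (s : RAMState) (b a v c : ℕ) : (s.setMem b a v).mem c =
    if c = b then Function.update (s.mem b) a v else s.mem c := Function.update_apply ..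

end RAMState

namespace RAMProgram

/-- A bound for the number of steps of a program in which every execution of a loop iterates at
most `B` times. -/
noncomputable def cost : RAMProgram → Polynomial ℕ
  | seq P Q => cost P + cost Q
  | ite _ P Q => cost P + cost Q + 1
  | .while _ P => (cost P + 1) * Polynomial.X + 1
  | _ => 1

/-- The condition on the initial state of a program under which it halts in a state that satisfies
`Q`, where each loop comes with an invariant that counts down from at most `B`. -/
def wp (B : ℕ) : RAMProgram → (RAMState → Prop) → RAMState → Prop
  | const x c, Q, s => Q (s.setReg x c)
  | add x y z, Q, s => Q (s.setReg x (s.reg y + s.reg z))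
  | sub x y z, Q, s => Q (s.setReg x (s.reg y - s.reg z))
  | load x b y, Q, s => Q (s.setReg x (s.mem b (s.reg y)))
  | store b y x, Q, s => Q (s.setMem b (s.reg y) (s.reg x))
  | seq P P', Q, s => wp B P (wp B P' Q) s
  | ite x P P', Q, s => (s.reg x ≠ 0 → wp B P Q s) ∧ (s.reg x = 0 → wp B P' Q s)
  | .while x P, Q, s => ∃ Inv : ℕ → RAMState → Prop, (∃ m ≤ B, Inv m s) ∧
      (∀ m s, Inv m s → s.reg x = 0 → Q s) ∧
      ∀ m s, Inv m s → s.reg x ≠ 0 → wp B P (fun s' => ∃ m' < m, Inv m' s') s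

theorem wp_mono {B : ℕ} {P : RAMProgram} {Q Q' : RAMState → Prop} {s : RAMState}
    (h : wp B P Q s) (hQ : ∀ s, Q s → Q' s) : wp B P Q' s := by
  induction P generalizing Q Q' s with
  | const | add | sub | load | store => exact hQ _ h
  | seq P P' ih ih' => exact ih h fun s hs => ih' hs hQ
  | ite x P P' ih ih' => exact ⟨fun hx => ih (h.1 hx) hQ, fun hx => ih' (h.2 hx) hQ⟩
  | _ x P ih =>
    obtain ⟨Inv, h0, h1, h2⟩ := h
    exact ⟨Inv, h0, fun m s hm hx => hQ _ (h1 m s hm hx), h2⟩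

theorem wp_seq {B : ℕ} {P P' : RAMProgram} {Q R : RAMState → Prop} {s : RAMState}
    (h : wp B P Q s) (h' : ∀ s, Q s → wp B P' R s) : wp B (seq P P') R s :=
  show wp B P (wp B P' R) s from wp_mono h h'

theorem exists_runs_of_wp {B : ℕ} {P : RAMProgram} {Q : RAMState → Prop} {s : RAMState}
    (h : wp B P Q s) : ∃ t s', t ≤ (cost P).eval B ∧ P.Runs s t s' ∧ Q s' := by
  induction P generalizing Q s with
  | const x c => exact ⟨1, _, by simp [cost], .const s x c, h⟩
  | add x y z => exact ⟨1, _, by simp [cost], .add s x y z, h⟩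
  | sub x y z => exact ⟨1, _, by simp [cost], .sub s x y z, h⟩
  | load x b y => exact ⟨1, _, by simp [cost], .load s x b y, h⟩
  | store b y x => exact ⟨1, _, by simp [cost], .store s b y x, h⟩
  | seq P P' ih ih' =>
    obtain ⟨t, s₁, ht, hr, h₁⟩ := ih h
    obtain ⟨u, s₂, hu, hr', h₂⟩ := ih' h₁
    exact ⟨t + u, s₂, by simp only [cost, Polynomial.eval_add]; omega, .seq hr hr', h₂⟩
  | ite x P P' ih ih' =>
    by_cases hx : s.reg x = 0
    · obtain ⟨t, s₁, ht, hr, h₁⟩ := ih' (h.2 hx)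
      exact ⟨t + 1, s₁, by simp only [cost, Polynomial.eval_add, Polynomial.eval_one]; omega,
        .ite_false hx hr, h₁⟩
    · obtain ⟨t, s₁, ht, hr, h₁⟩ := ih (h.1 hx)
      exact ⟨t + 1, s₁, by simp only [cost, Polynomial.eval_add, Polynomial.eval_one]; omega,
        .ite_true hx hr, h₁⟩
  | _ x P ih =>
    obtain ⟨Inv, ⟨m₀, hm₀, h₀⟩, h₁, h₂⟩ := h
    have key : ∀ m s, Inv m s → ∃ t s', t ≤ ((cost P).eval B + 1) * m + 1 ∧
        (RAMProgram.while x P).Runs s t s' ∧ Q s' := by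
      intro m
      induction m using Nat.strong_induction_on with
      | _ m ihm =>
        intro s hs
        by_cases hx : s.reg x = 0
        · exact ⟨1, s, by omega, .while_false hx, h₁ m s hs hx⟩
        · obtain ⟨t, s₁, ht, hr, m', hm', hi⟩ := ih (h₂ m s hs hx)
          obtain ⟨u, s₂, hu, hr', hq⟩ := ihm m' hm' s₁ hi
          refine ⟨t + u + 1, s₂, ?_, .while_true hx hr hr', hq⟩
          have : ((cost P).eval B + 1) * (m' + 1) ≤ ((cost P).eval B + 1) * m :=
            Nat.mul_le_mul_left _ hm'
          rw [Nat.mul_add] at this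
          omega
    obtain ⟨t, s', ht, hr, hq⟩ := key m₀ s h₀
    refine ⟨t, s', ht.trans ?_, hr, hq⟩
    simp only [cost, Polynomial.eval_add, Polynomial.eval_mul, Polynomial.eval_X,
      Polynomial.eval_one]
    have := Nat.mul_le_mul_left ((cost P).eval B + 1) hm₀
    omega

infixr:60 " ;; " => RAMProgram.seq

/-- Increment register `x`, with the help of register `9`. -/
def inc (x : ℕ) : RAMProgram := const 9 1 ;; add x x 9

/-- Do nothing that matters. -/
def skip : RAMProgram := const 9 0

/-- Run `P` with register `i` counting from `0` up to the contents of register `lim`; register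
`i + 1` is used for the test. -/
def forLoop (i lim : ℕ) (P : RAMProgram) : RAMProgram :=
  const i 0 ;; sub (i + 1) lim i ;; .while (i + 1) (P ;; inc i ;; sub (i + 1) lim i)

theorem wp_forLoop {B i lim : ℕ} {P : RAMProgram} {Q : RAMState → Prop} {s : RAMState}
    (N : ℕ) (Inv : ℕ → RAMState → Prop) (hlim : s.reg lim = N) (hN : N ≤ B)
    (h9 : 9 < i) (h9' : lim < 9)
    (hInv : ∀ j s x v, x = 9 ∨ x = i ∨ x = i + 1 → Inv j s → Inv j (s.setReg x v))
    (h0 : Inv 0 s)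
    (hstep : ∀ j s, j < N → s.reg i = j → s.reg lim = N → Inv j s →
      wp B P (fun s' => s'.reg i = j ∧ s'.reg lim = N ∧ Inv (j + 1) s') s)
    (hQ : ∀ s, Inv N s → Q s) : wp B (forLoop i lim P) Q s := by
  have hi : lim ≠ i := by omega
  have hi' : lim ≠ i + 1 := by omega
  have hi9 : i ≠ 9 := by omega
  have hl9 : lim ≠ 9 := by omega
  refine ⟨fun m s => ∃ j ≤ N, m = N - j ∧ s.reg i = j ∧ s.reg lim = N ∧ s.reg (i + 1) = N - j ∧
    Inv j s, ⟨N, hN, 0, by omega, by omega, ?_, ?_, ?_, ?_⟩, ?_, ?_⟩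
  · simp [RAMState.reg_setReg]
  · simp [RAMState.reg_setReg, hi, hi', hlim]
  · simp [RAMState.reg_setReg, hi, hlim]
  · exact hInv _ _ _ _ (by simp) (hInv _ _ _ _ (by simp) h0)
  · rintro m s ⟨j, hj, rfl, h1, h2, h3, h4⟩ hx
    obtain rfl : j = N := by omega
    exact hQ s h4
  · rintro m s ⟨j, hj, rfl, h1, h2, h3, h4⟩ hx
    have hjN : j < N := by omega
    refine wp_seq (hstep j s hjN h1 h2 h4) ?_
    rintro s' ⟨h1', h2', h4'⟩
    refine ⟨N - (j + 1), by omega, j + 1, by omega, rfl, ?_, ?_, ?_, ?_⟩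
    · simp [RAMState.reg_setReg, h1', hi9]
    · simp [RAMState.reg_setReg, hi, hi', h2', hl9]
    · simp [RAMState.reg_setReg, hi, h1', h2', hl9, hi9]
    · exact hInv _ _ _ _ (by simp) (hInv _ _ _ _ (by simp) (hInv _ _ _ _ (by simp) h4'))

end RAMProgram

/-! ### The adjacency matrix in the memory -/

section Adjacency

open RAMProgram

attribute [simp] RAMState.reg_setReg RAMState.mem_setReg RAMState.reg_setMem RAMState.mem_setMem wp
  inc skip

/-- Adjacency of vertices that are given as natural numbers. -/
def GraphInstance.adj (J : GraphInstance) (i j : ℕ) : Prop :=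
  ∃ (hi : i < J.n) (hj : j < J.n), J.graph.Adj ⟨i, hi⟩ ⟨j, hj⟩

namespace GraphInstance

variable {J : GraphInstance} {i j : ℕ}

theorem adj.symm (h : J.adj i j) : J.adj j i := by
  obtain ⟨hi, hj, h⟩ := h
  exact ⟨hj, hi, h.symm⟩

theorem adj.lt_left (h : J.adj i j) : i < J.n := h.1

theorem adj.lt_right (h : J.adj i j) : j < J.n := h.2.1

theorem adj.ne (h : J.adj i j) : i ≠ j := by
  rintro rfl
  obtain ⟨hi, hj, h⟩ := h
  exact h.ne rfl

theorem adj_coe (J : GraphInstance) (i j : Fin J.n) : J.adj i j ↔ J.graph.Adj i j :=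
  ⟨fun ⟨_, _, h⟩ => h, fun h => ⟨i.2, j.2, h⟩⟩

end GraphInstance

namespace RAMState

open Classical in
/-- Bank `b` holds the adjacency matrix of `J`. -/
def HoldsMatrix (b : ℕ) (J : GraphInstance) (s : RAMState) : Prop :=
  ∀ i < J.n, ∀ j < J.n, s.mem b (i * J.n + j) = if J.adj i j then 1 else 0

open Classical in
theorem outputs_iff (s : RAMState) (J : GraphInstance) :
    s.Outputs J ↔ s.reg 0 = J.n ∧ s.reg 1 = J.k ∧ s.HoldsMatrix 0 J := by
  refine and_congr_right fun _ => and_congr_right fun _ => ⟨fun h i hi j hj => ?_, fun h i j => ?_⟩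
  · rw [h ⟨i, hi⟩ ⟨j, hj⟩]
    exact if_congr (J.adj_coe ⟨i, hi⟩ ⟨j, hj⟩).symm rfl rfl
  · rw [h i i.2 j j.2]
    exact if_congr (J.adj_coe i j) rfl rfl

open Classical in
theorem outputs_init (I : GraphInstance) : (init I).Outputs I := by
  rw [outputs_iff]
  refine ⟨rfl, rfl, fun i hi j hj => ?_⟩
  have key : (∃ i' j' : Fin I.n, I.graph.Adj i' j' ∧ i * I.n + j = i' * I.n + j') ↔ I.adj i j := by
    constructor
    · rintro ⟨i', j', h, he⟩
      have h1 : i = i' := by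
        have := congrArg (· / I.n) he
        have hn : 0 < I.n := by omega
        simpa [Nat.mul_comm _ I.n, Nat.mul_add_div hn, Nat.div_eq_of_lt hj,
          Nat.div_eq_of_lt j'.2] using this
      subst h1
      have h2 : j = j' := by omega
      subst h2
      exact (I.adj_coe i' j').2 h
    · rintro ⟨hi, hj, h⟩
      exact ⟨_, _, h, rfl⟩
  exact if_congr (by simpa using key) rfl rfl

/-- Register `0` holds the number of vertices of `J`, bank `1` its adjacency matrix, and bank `2`
the addresses where the rows of the matrix start. -/
def HoldsRows (J : GraphInstance) (s : RAMState) : Prop :=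
  s.reg 0 = J.n ∧ (∀ i < J.n, s.mem 2 i = i * J.n) ∧ s.HoldsMatrix 1 J

/-- In addition, bank `0` still holds the adjacency matrix of `J`. -/
def HoldsGraph (J : GraphInstance) (s : RAMState) : Prop := s.HoldsRows J ∧ s.HoldsMatrix 0 J

variable {J : GraphInstance} {s : RAMState}

theorem HoldsRows.reg_zero (h : s.HoldsRows J) : s.reg 0 = J.n := h.1

theorem HoldsGraph.reg_zero (h : s.HoldsGraph J) : s.reg 0 = J.n := h.1.1

@[simp]
theorem holdsRows_setReg {x : ℕ} (hx : x ≠ 0) (v : ℕ) :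
    (s.setReg x v).HoldsRows J ↔ s.HoldsRows J := by
  simp [HoldsRows, HoldsMatrix, hx.symm]

@[simp]
theorem holdsRows_setMem {b : ℕ} (h1 : b ≠ 1) (h2 : b ≠ 2) (a v : ℕ) :
    (s.setMem b a v).HoldsRows J ↔ s.HoldsRows J := by
  simp [HoldsRows, HoldsMatrix, h1.symm, h2.symm]

@[simp]
theorem holdsGraph_setReg {x : ℕ} (hx : x ≠ 0) (v : ℕ) :
    (s.setReg x v).HoldsGraph J ↔ s.HoldsGraph J := by
  simp [HoldsGraph, HoldsMatrix, hx]

@[simp]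
theorem holdsGraph_setMem {b : ℕ} (h0 : b ≠ 0) (h1 : b ≠ 1) (h2 : b ≠ 2) (a v : ℕ) :
    (s.setMem b a v).HoldsGraph J ↔ s.HoldsGraph J := by
  simp [HoldsGraph, HoldsMatrix, h0.symm, h1, h2]

open Classical in
theorem HoldsRows.mem_adj (h : s.HoldsRows J) {i j : ℕ} (hi : i < J.n) (hj : j < J.n) :
    s.mem 1 (s.mem 2 i + j) = if J.adj i j then 1 else 0 := by
  rw [h.2.1 i hi, h.2.2 i hi j hj]

end RAMState

namespace RAMProgram

/-- Copy register `y` to register `x`. -/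
def mov (x y : ℕ) : RAMProgram := const 9 0 ;; add x y 9

/-- Set register `x` to the entry of the adjacency matrix for the vertices in the registers `u`
and `v`. -/
def edge (x u v : ℕ) : RAMProgram := load x 2 u ;; add x x v ;; load x 1 x

attribute [simp] mov edge

/-- Copy the matrix from bank `0` to bank `1`, and tabulate the addresses of its rows. -/
def copyMatrix : RAMProgram :=
  const 5 0 ;; forLoop 10 0 (store 2 10 5 ;;
    forLoop 12 0 (load 6 0 5 ;; store 1 5 6 ;; inc 5))

theorem wp_copyMatrix {B : ℕ} {J : GraphInstance} {s : RAMState} (hB : J.n ≤ B)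
    (h : s.Outputs J) :
    wp B copyMatrix (fun s' => s'.HoldsGraph J ∧ s'.reg 1 = J.k) s := by
  rw [RAMState.outputs_iff] at h
  obtain ⟨h0, h1, hM⟩ := h
  refine wp_forLoop J.n (fun i s' => s'.reg 0 = J.n ∧ s'.reg 1 = J.k ∧ s'.mem 0 = s.mem 0 ∧
    s'.reg 5 = i * J.n ∧ (∀ a < i, s'.mem 2 a = a * J.n) ∧
    ∀ a < i * J.n, s'.mem 1 a = s.mem 0 a) (by simpa using h0) hB (by simp) (by simp)
    ?_ ?_ ?_ ?_
  · rintro j s x v (rfl | rfl | rfl) h <;> simpa using h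
  · simp [h0, h1]
  · rintro i s₁ hi hri - ⟨h0', h1', h2', h3', h4', h5'⟩
    refine wp_forLoop J.n (fun j s' => s'.reg 10 = i ∧ s'.reg 0 = J.n ∧ s'.reg 1 = J.k ∧
      s'.mem 0 = s.mem 0 ∧
      s'.reg 5 = i * J.n + j ∧ (∀ a < i + 1, s'.mem 2 a = a * J.n) ∧
      ∀ a < i * J.n + j, s'.mem 1 a = s.mem 0 a) (by simpa using h0') hB (by simp) (by simp)
      ?_ ?_ ?_ ?_
    · rintro j s x v (rfl | rfl | rfl) h <;> simpa using h
    · refine ⟨by simpa using hri, by simpa using h0', by simpa using h1', by simpa using h2',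
        by simpa using h3', fun a ha => ?_, fun a ha => by simpa using h5' a (by simpa using ha)⟩
      simp only [RAMState.mem_setMem, if_true, hri, h3', Function.update_apply]
      split_ifs with hai
      · rw [hai]
      · exact h4' a (by omega)
    · rintro j s₂ hj hrj - ⟨g1, g2, g3, g4, g5, g6, g7⟩
      simp [g1, g2, g3, g4, g5, hrj, ← Nat.add_assoc]
      refine ⟨fun a ha => g6 a (by omega), fun a ha => ?_⟩
      rw [Function.update_apply]
      split_ifs with hai
      · rw [hai]
      · exact g7 a (by omega)
    · rintro s₂ ⟨g1, g2, g3, g4, g5, g6, g7⟩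
      refine ⟨g1, g2, g2, g3, g4, by rw [g5, Nat.succ_mul], g6, ?_⟩
      rwa [Nat.succ_mul]
  · rintro s₁ ⟨g1, g2, g3, g4, g5, g6⟩
    refine ⟨⟨⟨g1, g5, fun i hi j hj => ?_⟩, by simpa [RAMState.HoldsMatrix, g3] using hM⟩, g2⟩
    rw [g6, hM i hi j hj]
    calc i * J.n + j < i * J.n + J.n := by omega
      _ = (i + 1) * J.n := by rw [Nat.succ_mul]
      _ ≤ J.n * J.n := Nat.mul_le_mul_right _ hi

end RAMProgram

end Adjacency

/-! ### A maximal matching -/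

section Greedy

open RAMProgram

namespace GraphInstance

/-- The vertices marked by `st` are the endpoints of a matching that consists of the edges between
`v` and `g v` for `v ∈ S`. -/
structure IsMatchedBy (J : GraphInstance) (st : ℕ → ℕ) (S : Finset ℕ) (g : ℕ → ℕ) : Prop where
  adj : ∀ v ∈ S, J.adj v (g v)
  notMem : ∀ v ∈ S, g v ∉ S
  inj : Set.InjOn g S
  ne_zero_iff : ∀ v < J.n, st v ≠ 0 ↔ v ∈ S ∨ v ∈ S.image g

variable {J : GraphInstance} {st : ℕ → ℕ}

theorem IsMatchedBy.insert_edge {S : Finset ℕ} {g : ℕ → ℕ} (h : J.IsMatchedBy st S g) {i j : ℕ}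
    (hij : J.adj i j) (hi : st i = 0) (hj : st j = 0) :
    J.IsMatchedBy (Function.update (Function.update st i 1) j 1) (insert i S)
      (Function.update g i j) := by
  have hi' : i ∉ S ∧ i ∉ S.image g := by
    have := (h.ne_zero_iff i hij.lt_left).not.1 (by simpa using hi)
    tauto
  have hj' : j ∉ S ∧ j ∉ S.image g := by
    have := (h.ne_zero_iff j hij.lt_right).not.1 (by simpa using hj)
    tauto
  have hg : ∀ v ∈ S, Function.update g i j v = g v := by
    intro v hv
    rw [Function.update_of_ne]
    rintro rfl
    exact hi'.1 hv
  have himg : (insert i S).image (Function.update g i j) = insert j (S.image g) := by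
    rw [Finset.image_insert, Function.update_self]
    exact congrArg _ (Finset.image_congr hg)
  constructor
  · intro v hv
    rcases Finset.mem_insert.1 hv with rfl | hv
    · simpa using hij
    · rw [hg v hv]
      exact h.adj v hv
  · intro v hv
    rcases Finset.mem_insert.1 hv with rfl | hvS
    · simpa using ⟨hij.ne.symm, hj'.1⟩
    · rw [hg v hvS, Finset.mem_insert, not_or]
      refine ⟨?_, h.notMem v hvS⟩
      rintro rfl
      exact hi'.2 (Finset.mem_image_of_mem g hvS)
  · rw [Finset.coe_insert, Set.injOn_insert (by simpa using hi'.1)]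
    refine ⟨h.inj.congr fun v hv => (hg v hv).symm, ?_⟩
    rintro ⟨v, hv, he⟩
    rw [Function.update_self, hg v hv] at he
    exact hj'.2 (he ▸ Finset.mem_image_of_mem g hv)
  · intro v hv
    have := h.ne_zero_iff v hv
    rw [himg, Finset.mem_insert, Finset.mem_insert, Function.update_apply, Function.update_apply]
    split_ifs with h1 h2
    · simp [h1]
    · simp [h2]
    · simp only [h1, h2, false_or, this]

/-- The vertices marked by `st` are the endpoints of a matching. -/
def IsMatched (J : GraphInstance) (st : ℕ → ℕ) : Prop := ∃ S g, J.IsMatchedBy st S g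

end GraphInstance

namespace RAMProgram

/-- Mark in bank `3` the endpoints of a maximal matching. -/
def maximalMatching : RAMProgram :=
  forLoop 10 0 (const 5 0 ;; store 3 10 5) ;;
  forLoop 10 0 (forLoop 12 0 (load 5 3 10 ;; ite 5 skip (load 5 3 12 ;; ite 5 skip
    (edge 5 10 12 ;; ite 5 (store 3 10 5 ;; store 3 12 5) skip))))

theorem wp_maximalMatching {B : ℕ} {J : GraphInstance} {s : RAMState} (hB : J.n ≤ B) {k : ℕ}
    (h : s.HoldsGraph J) (hk : s.reg 1 = k) :
    wp B maximalMatching (fun s' => s'.HoldsGraph J ∧ s'.reg 1 = k ∧ J.IsMatched (s'.mem 3) ∧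
      ∀ u v, J.adj u v → s'.mem 3 u ≠ 0 ∨ s'.mem 3 v ≠ 0) s := by
  refine wp_forLoop J.n (fun i s' => s'.HoldsGraph J ∧ s'.reg 1 = k ∧ ∀ v < i, s'.mem 3 v = 0)
    h.reg_zero hB (by simp) (by simp) ?_ ?_ ?_ ?_
  · rintro j s x v (rfl | rfl | rfl) h <;> simpa using h
  · exact ⟨h, hk, by simp⟩
  · rintro i s₁ hi hri hr0 ⟨g1, g2, g3⟩
    simp [hri, hr0, g1, g2]
    intro v hv
    rw [Function.update_apply]
    split_ifs with hvi
    · rfl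
    · exact g3 v (by omega)
  rintro s₁ ⟨g1, g2, g3⟩
  refine wp_forLoop J.n (fun i s' => s'.HoldsGraph J ∧ s'.reg 1 = k ∧ J.IsMatched (s'.mem 3) ∧
    ∀ u v, u < i → J.adj u v → s'.mem 3 u ≠ 0 ∨ s'.mem 3 v ≠ 0)
    g1.reg_zero hB (by simp) (by simp) ?_ ?_ ?_ ?_
  · rintro j s x v (rfl | rfl | rfl) h <;> simpa using h
  · exact ⟨g1, g2, ⟨∅, id, by simp, by simp, by simp, fun v hv => by simp [g3 v hv]⟩, by simp⟩
  · rintro i s₂ hi hri hr0 ⟨f1, f2, f3, f4⟩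
    refine wp_forLoop J.n (fun j s' => s'.reg 10 = i ∧ s'.HoldsGraph J ∧ s'.reg 1 = k ∧
      J.IsMatched (s'.mem 3) ∧
      ∀ u v, u < i ∨ u = i ∧ v < j → J.adj u v → s'.mem 3 u ≠ 0 ∨ s'.mem 3 v ≠ 0)
      f1.reg_zero hB (by simp) (by simp) ?_ ?_ ?_ ?_
    · rintro j s x v (rfl | rfl | rfl) h <;> simpa using h
    · exact ⟨hri, f1, f2, f3, fun u v huv => f4 u v (by omega)⟩
    · rintro j s₃ hj hrj hr0 ⟨e1, e2, e3, e4, e5⟩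
      have hadj := e2.1.mem_adj hi hj
      have hdone : (J.adj i j → s₃.mem 3 i ≠ 0 ∨ s₃.mem 3 j ≠ 0) → ∀ u v,
          u < i ∨ u = i ∧ v ≤ j → J.adj u v → s₃.mem 3 u ≠ 0 ∨ s₃.mem 3 v ≠ 0 := by
        intro hd u v huv h
        by_cases hj : u = i ∧ v = j
        · exact hj.1 ▸ hj.2 ▸ hd (hj.1 ▸ hj.2 ▸ h)
        · exact e5 u v (by omega) h
      simp [e1, e2, e3, e4, hrj, hr0, hadj]
      refine ⟨fun hi => hdone fun _ => Or.inl hi, fun hi0 => ⟨fun hj => hdone fun _ => Or.inr hj,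
        fun hj0 => ⟨fun hij => ?_, fun hij => hdone fun h => absurd h hij⟩⟩⟩
      obtain ⟨S, g, hS⟩ := e4
      simp only [if_pos hij]
      refine ⟨⟨_, _, hS.insert_edge hij hi0 hj0⟩, fun u v huv h => ?_⟩
      have hmono : ∀ w, s₃.mem 3 w ≠ 0 ∨ w = i ∨ w = j →
          Function.update (Function.update (s₃.mem 3) i 1) j 1 w ≠ 0 := by
        intro w hw
        rw [Function.update_apply, Function.update_apply]
        split_ifs <;> simp_all
      by_cases hj : u = i
      · exact Or.inl (hmono u (by simp [hj]))
      · exact (e5 u v (by omega) h).imp (fun h => hmono u (Or.inl h)) fun h => hmono v (Or.inl h)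
    · rintro s₃ ⟨e1, e2, e3, e4, e5⟩
      refine ⟨e1, e2.reg_zero, e2, e3, e4, fun u v hu huv => e5 u v ?_ huv⟩
      have := huv.lt_right
      omega
  · rintro s₂ ⟨f1, f2, f3, f4⟩
    exact ⟨f1, f2, f3, fun u v h => f4 u v h.lt_left h⟩

end RAMProgram

end Greedy

/-! ### Matching by an auction -/

section Auction

open RAMProgram

namespace GraphInstance

/-- The state of an auction in which the vertices in `U` buy neighbors: `st` marks the vertices
outside `U` and the buyers that own a vertex, `p` is the list of prices, and `m h` is the owner of
`h`, or `J.n` if there is none. No buyer could have saved more than `1` on the price to date. -/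
structure IsAuction (J : GraphInstance) (U : ℕ → Prop) (st p m : ℕ → ℕ) : Prop where
  mark : ∀ u < J.n, ¬ U u → st u ≠ 0
  sold : ∀ u < J.n, U u → st u ≠ 0 → ∃ h < J.n, 0 < p h ∧ m h = u
  owner : ∀ h < J.n, 0 < p h → U (m h) ∧ J.adj (m h) h ∧ st (m h) ≠ 0
  cheap : ∀ h < J.n, 0 < p h → ∀ h', J.adj (m h) h' → p h ≤ p h' + 1
  unsold : ∀ h < J.n, p h = 0 → m h = J.n
  inj : ∀ h < J.n, ∀ h' < J.n, 0 < p h → 0 < p h' → m h = m h' → h = h'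
  le : ∀ h < J.n, p h ≤ J.n + 1

variable {J : GraphInstance} {U : ℕ → Prop} {st p m : ℕ → ℕ}

theorem IsAuction.buy (H : J.IsAuction U st p m) {u h : ℕ} (hu : st u = 0) (huh : J.adj u h)
    (hp : p h < J.n + 1) (hmin : ∀ h', J.adj u h' → p h ≤ p h') :
    J.IsAuction U (Function.update (Function.update st (m h) 0) u 1)
      (Function.update p h (p h + 1)) (Function.update m h u) := by
  have hUu : U u := by
    by_contra hU
    exact H.mark u huh.lt_left hU hu
  have hpos : ∀ {h'}, h' ≠ h → 0 < Function.update p h (p h + 1) h' → 0 < p h' := by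
    intro h' hne h0
    rwa [Function.update_of_ne hne] at h0
  have hmu : ∀ h' < J.n, 0 < p h' → m h' ≠ u := by
    rintro h' hh' h0 rfl
    exact (H.owner h' hh' h0).2.2 hu
  have hmono : ∀ h', p h' ≤ Function.update p h (p h + 1) h' := by
    intro h'
    rw [Function.update_apply]
    split_ifs with e
    · rw [e]; omega
    · rfl
  constructor
  · intro v hv hU
    have := H.mark v hv hU
    have hvm : v ≠ m h := by
      rintro rfl
      rcases Nat.eq_zero_or_pos (p h) with h0 | h0
      · have := H.unsold h huh.lt_right h0
        omega
      · exact hU (H.owner h huh.lt_right h0).1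
    rw [Function.update_apply, Function.update_apply]
    split_ifs <;> simp_all
  · intro v hv hU hst
    by_cases hvu : v = u
    · exact ⟨h, huh.lt_right, by simp, by simp [hvu]⟩
    · rw [Function.update_of_ne hvu, Function.update_apply] at hst
      split_ifs at hst with hvm
      · simp at hst
      · obtain ⟨h', hh', h0, rfl⟩ := H.sold v hv hU hst
        have hne : h' ≠ h := by rintro rfl; exact hvm rfl
        exact ⟨h', hh', h0.trans_le (hmono h'), by rw [Function.update_of_ne hne]⟩
  · intro h' hh' h0
    by_cases hne : h' = h
    · subst hne
      simpa using ⟨hUu, huh⟩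
    · have h0' := hpos hne h0
      obtain ⟨a, b, c⟩ := H.owner h' hh' h0'
      have hmm : m h' ≠ m h := by
        intro e
        rcases Nat.eq_zero_or_pos (p h) with h1 | h1
        · have := H.unsold h huh.lt_right h1
          have := b.lt_left
          omega
        · exact hne (H.inj h' hh' h huh.lt_right h0' h1 e)
      rw [Function.update_of_ne hne, Function.update_of_ne (hmu h' hh' h0'),
        Function.update_of_ne hmm]
      exact ⟨a, b, c⟩
  · intro h' hh' h0 h'' hadj
    refine le_trans ?_ (Nat.add_le_add_right (hmono h'') 1)
    by_cases hne : h' = h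
    · subst hne
      rw [Function.update_self] at hadj ⊢
      have := hmin h'' hadj
      omega
    · rw [Function.update_of_ne hne] at hadj ⊢
      exact H.cheap h' hh' (hpos hne h0) h'' hadj
  · intro h' hh' h0
    by_cases hne : h' = h
    · subst hne; simp at h0
    · rw [Function.update_of_ne hne] at h0 ⊢
      exact H.unsold h' hh' h0
  · intro h₁ hh₁ h₂ hh₂ h01 h02 he
    by_cases e1 : h₁ = h <;> by_cases e2 : h₂ = h
    · rw [e1, e2]
    · subst e1
      rw [Function.update_self, Function.update_of_ne e2] at he
      exact absurd he.symm (hmu h₂ hh₂ (hpos e2 h02))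
    · subst e2
      rw [Function.update_self, Function.update_of_ne e1] at he
      exact absurd he (hmu h₁ hh₁ (hpos e1 h01))
    · rw [Function.update_of_ne e1, Function.update_of_ne e2] at he
      exact H.inj h₁ hh₁ h₂ hh₂ (hpos e1 h01) (hpos e2 h02) he
  · intro h' hh'
    rw [Function.update_apply]
    split_ifs
    · omega
    · exact H.le h' hh'

theorem isAuction_zero (st₀ : ℕ → ℕ) (hp : ∀ h < J.n, p h = 0) (hm : ∀ h < J.n, m h = J.n) :
    J.IsAuction (fun u => st₀ u = 0) st₀ p m where
  mark _ _ h := h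
  sold _ _ h h' := absurd h h'
  owner h hh h0 := by simp [hp h hh] at h0
  cheap h hh h0 := by simp [hp h hh] at h0
  unsold h hh _ := hm h hh
  inj h hh _ _ h0 := by simp [hp h hh] at h0
  le h hh := by simp [hp h hh]

/-- The sum of the amounts by which the prices can still rise. -/
def potential (J : GraphInstance) (p : ℕ → ℕ) : ℕ := ∑ h ∈ Finset.range J.n, (J.n + 1 - p h)

theorem potential_le (J : GraphInstance) (p : ℕ → ℕ) : J.potential p ≤ J.n * (J.n + 1) := by
  refine (Finset.sum_le_card_nsmul _ _ (J.n + 1) fun h _ => Nat.sub_le _ _).trans ?_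
  simp

theorem potential_update_lt {h : ℕ} (hh : h < J.n) (hp : p h < J.n + 1) :
    J.potential (Function.update p h (p h + 1)) < J.potential p := by
  refine Finset.sum_lt_sum (fun h' _ => ?_) ⟨h, Finset.mem_range.2 hh, ?_⟩
  · rw [Function.update_apply]
    split_ifs with e
    · subst e; omega
    · rfl
  · rw [Function.update_self]
    omega

end GraphInstance

namespace RAMProgram

/-- Set register `4` to a vertex `u` that is not marked in bank `3`, or to the number of vertices
if there is none. -/
def findUnmarked : RAMProgram :=
  mov 4 0 ;; forLoop 10 0 (load 5 3 10 ;; ite 5 skip (mov 4 10))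

/-- Set register `7` to a neighbor of minimal price of the vertex in register `4`, and register `6`
to its price, if this is at most the number `n` of vertices. Otherwise, set register `7` to `n`. -/
def findCheapest : RAMProgram :=
  const 5 1 ;; add 6 0 5 ;; mov 7 0 ;;
  forLoop 10 0 (edge 5 4 10 ;; ite 5 (load 5 4 10 ;; sub 8 6 5 ;; ite 8 (mov 6 5 ;; mov 7 10) skip)
    skip)

/-- Let the vertices that are not marked in bank `3` buy their neighbors until all of them are
marked, or one of them, to be found in register `4`, has no neighbor of price at most `n`. -/
def auction : RAMProgram :=
  forLoop 10 0 (const 5 0 ;; store 4 10 5 ;; store 5 10 0) ;; const 3 1 ;;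
  .while 3 (findUnmarked ;; sub 5 0 4 ;; ite 5 (findCheapest ;; sub 5 0 7 ;; ite 5
    (load 5 5 7 ;; const 8 0 ;; store 3 5 8 ;; store 5 7 4 ;; const 5 1 ;; store 3 4 5 ;;
      add 6 6 5 ;; store 4 7 6)
    (const 3 0)) (const 3 0))

variable {B : ℕ} {J : GraphInstance} {s : RAMState}

theorem wp_findUnmarked (hB : J.n ≤ B) (h : s.HoldsGraph J) :
    wp B findUnmarked (fun s' => s'.HoldsGraph J ∧ s'.reg 1 = s.reg 1 ∧ s'.reg 3 = s.reg 3 ∧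
      s'.mem = s.mem ∧ ((s'.reg 4 = J.n ∧ ∀ u < J.n, s.mem 3 u ≠ 0) ∨
        s'.reg 4 < J.n ∧ s.mem 3 (s'.reg 4) = 0)) s := by
  refine wp_forLoop J.n (fun i s' => s'.HoldsGraph J ∧ s'.reg 1 = s.reg 1 ∧ s'.reg 3 = s.reg 3 ∧
    s'.mem = s.mem ∧ ((s'.reg 4 = J.n ∧ ∀ u < i, s.mem 3 u ≠ 0) ∨
        s'.reg 4 < J.n ∧ s.mem 3 (s'.reg 4) = 0)) (by simpa using h.reg_zero) hB (by simp) (by simp)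
        ?_ ?_ ?_ ?_
  · rintro j s x v (rfl | rfl | rfl) h <;> simpa using h
  · simp [h, h.reg_zero]
  · rintro i s₁ hi hri hr0 ⟨g1, g2, g3, g4, g5⟩
    simp only [wp, skip, mov, RAMState.reg_setReg, RAMState.mem_setReg]
    refine ⟨fun hne => ?_, fun h0 => ?_⟩
    · simp [g1, g2, g3, g4, hri, hr0]
      refine g5.imp_left fun ⟨a, b⟩ => ⟨a, fun u hu => ?_⟩
      rcases (show u < i ∨ u = i by omega) with h | rfl
      · exact b u h
      · simpa [hri, g4] using hne
    · have : s.mem 3 i = 0 := by simpa [hri, g4] using h0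
      simp [g1, g2, g3, g4, hri, hr0, hi, this]
  · exact fun s' hs => hs

theorem wp_findCheapest (hB : J.n ≤ B) (h : s.HoldsGraph J) (hu : s.reg 4 < J.n) :
    wp B findCheapest (fun s' => s'.HoldsGraph J ∧ s'.reg 1 = s.reg 1 ∧ s'.reg 3 = s.reg 3 ∧
      s'.reg 4 = s.reg 4 ∧ s'.mem = s.mem ∧
      (∀ h, J.adj (s.reg 4) h → s'.reg 6 ≤ s.mem 4 h) ∧
      ((s'.reg 7 = J.n ∧ s'.reg 6 = J.n + 1) ∨
        J.adj (s.reg 4) (s'.reg 7) ∧ s'.reg 6 = s.mem 4 (s'.reg 7) ∧ s'.reg 6 < J.n + 1)) s := by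
  refine wp_forLoop J.n (fun i s' => s'.HoldsGraph J ∧ s'.reg 1 = s.reg 1 ∧ s'.reg 3 = s.reg 3 ∧
      s'.reg 4 = s.reg 4 ∧ s'.mem = s.mem ∧
      (∀ h < i, J.adj (s.reg 4) h → s'.reg 6 ≤ s.mem 4 h) ∧
      ((s'.reg 7 = J.n ∧ s'.reg 6 = J.n + 1) ∨
        J.adj (s.reg 4) (s'.reg 7) ∧ s'.reg 6 = s.mem 4 (s'.reg 7) ∧ s'.reg 6 < J.n + 1))
      (by simpa using h.reg_zero) hB (by simp) (by simp) ?_ ?_ ?_ ?_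
  · rintro j s x v (rfl | rfl | rfl) h <;> simpa using h
  · simp [h, h.reg_zero]
  · rintro i s₁ hi hri hr0 ⟨g1, g2, g3, g4, g5, g6, g7⟩
    have hadj := h.1.mem_adj hu hi
    have hlast : (J.adj (s.reg 4) i → s₁.reg 6 ≤ s.mem 4 i) →
        ∀ h ≤ i, J.adj (s.reg 4) h → s₁.reg 6 ≤ s.mem 4 h := by
      intro hl h hh hh'
      rcases (show h < i ∨ h = i by omega) with e | rfl
      · exact g6 h e hh'
      · exact hl hh'
    simp [g1, g2, g3, g4, g5, hri, hr0, hadj]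
    refine ⟨fun hij => ⟨fun hlt => ⟨fun h hh hh' => ?_, Or.inr ⟨hij, ?_⟩⟩,
      fun hle => ⟨hlast fun _ => by omega, by simpa using g7⟩⟩,
      fun hij => ⟨hlast fun h => absurd h hij, by simpa using g7⟩⟩
    · rcases (show h < i ∨ h = i by omega) with e | rfl
      · have := g6 h e hh'
        omega
      · rfl
    · omega
  · rintro s' ⟨g1, g2, g3, g4, g5, g6, g7⟩
    exact ⟨g1, g2, g3, g4, g5, fun h hh => g6 h hh.lt_right hh, g7⟩

theorem wp_auction (hB : (J.n + 2) ^ 2 ≤ B) (h : s.HoldsGraph J) :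
    wp B auction (fun s' => s'.HoldsGraph J ∧ s'.reg 1 = s.reg 1 ∧
      J.IsAuction (fun u => s.mem 3 u = 0) (s'.mem 3) (s'.mem 4) (s'.mem 5) ∧
      ((s'.reg 4 = J.n ∧ ∀ u < J.n, s'.mem 3 u ≠ 0) ∨ s'.reg 4 < J.n ∧ s'.mem 3 (s'.reg 4) = 0 ∧
        ∀ h, J.adj (s'.reg 4) h → J.n + 1 ≤ s'.mem 4 h)) s := by
  have hB' : J.n ≤ B := by nlinarith
  have hB'' : J.n * (J.n + 1) + 1 ≤ B := by nlinarith
  refine wp_forLoop J.n (fun i s' => s'.HoldsGraph J ∧ s'.reg 1 = s.reg 1 ∧ s'.mem 3 = s.mem 3 ∧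
    (∀ h < i, s'.mem 4 h = 0) ∧ ∀ h < i, s'.mem 5 h = J.n) h.reg_zero hB' (by simp) (by simp)
    ?_ ?_ ?_ ?_
  · rintro j s x v (rfl | rfl | rfl) h <;> simpa using h
  · simp [h]
  · rintro i s₁ hi hri hr0 ⟨g1, g2, g3, g4, g5⟩
    simp [g1, g2, g3, hri, hr0]
    constructor <;> intro h hh <;> rw [Function.update_apply] <;> split_ifs <;>
      first | rfl | exact g4 h (by omega) | exact g5 h (by omega)
  rintro s₁ ⟨g1, g2, g3, g4, g5⟩
  refine ⟨fun m s' => s'.HoldsGraph J ∧ s'.reg 1 = s.reg 1 ∧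
    J.IsAuction (fun u => s.mem 3 u = 0) (s'.mem 3) (s'.mem 4) (s'.mem 5) ∧
    (s'.reg 3 ≠ 0 → m = J.potential (s'.mem 4) + 1) ∧ (s'.reg 3 = 0 →
      ((s'.reg 4 = J.n ∧ ∀ u < J.n, s'.mem 3 u ≠ 0) ∨ s'.reg 4 < J.n ∧ s'.mem 3 (s'.reg 4) = 0 ∧
        ∀ h, J.adj (s'.reg 4) h → J.n + 1 ≤ s'.mem 4 h)),
    ⟨J.potential (s₁.mem 4) + 1, by have := J.potential_le (s₁.mem 4); omega, ?_⟩, ?_, ?_⟩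
  · simp [g1, g2, g3]
    exact GraphInstance.isAuction_zero _ g4 g5
  · rintro m s' ⟨f1, f2, f3, f4, f5⟩ hx
    exact ⟨f1, f2, f3, f5 hx⟩
  · rintro m s₂ ⟨f1, f2, f3, f4, -⟩ hx
    obtain rfl := f4 hx
    refine wp_seq (wp_findUnmarked hB' f1) ?_
    rintro s₃ ⟨e1, e2, e3, e4, e5⟩
    refine ⟨fun hlt => ?_, fun hge => ?_⟩
    · have hlt' : s₃.reg 4 < J.n := by simpa [e1.reg_zero, Nat.sub_eq_zero_iff_le] using hlt
      have hu0 := (e5.resolve_left fun h => by omega).2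
      refine wp_seq (wp_findCheapest hB' (by simpa using e1) (by simpa using hlt')) ?_
      rintro s₄ ⟨d1, d2, d3, d4, d5, d6, d7⟩
      simp only [RAMState.reg_setReg, RAMState.mem_setReg, e4, Nat.reduceEqDiff, if_false]
        at d2 d3 d4 d5 d6 d7
      refine ⟨fun hlt2 => ?_, fun hge2 => ?_⟩
      · simp only [RAMState.reg_setReg, if_true, d1.reg_zero] at hlt2
        obtain ⟨hadj, hp, hpn⟩ := d7.resolve_left fun h => by omega
        have hbuy := f3.buy hu0 hadj (by omega) (fun h' hh' => hp ▸ d6 h' hh')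
        have hpot := GraphInstance.potential_update_lt hadj.lt_right (hp ▸ hpn)
        refine ⟨_, Nat.add_lt_add_right hpot 1, ?_⟩
        simp [d1, d2, d3, d4, d5, e2, e3, f2, hx, hp, hbuy]
      · simp only [RAMState.reg_setReg, if_true, d1.reg_zero] at hge2
        refine ⟨0, by omega, ?_⟩
        obtain ⟨h7, h6⟩ := d7.resolve_right fun h => by have := h.1.lt_right; omega
        simp [d1, d2, d4, d5, e2, f2, f3, hlt', hu0]
        exact Or.inr fun h hh => by have := d6 h hh; omega
    · have hge' : J.n ≤ s₃.reg 4 := by simpa [e1.reg_zero, Nat.sub_eq_zero_iff_le] using hge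
      refine ⟨0, by omega, ?_⟩
      have := e5.resolve_right fun h => by omega
      simp [e1, e2, e4, f2, f3, this]
      exact this.2

end RAMProgram

end Auction

/-! ### Removal of a crown -/

section Crown

open RAMProgram

namespace GraphInstance

variable {J : GraphInstance} {st p m : ℕ → ℕ}

/-- If a buyer is left over, then some price between `1` and the number of vertices does not
occur. -/
theorem IsAuction.exists_gap {U : ℕ → Prop} (H : J.IsAuction U st p m)
    (hU : ∀ u v, J.adj u v → U u → ¬ U v) {u : ℕ} (hu : u < J.n) (hst : st u = 0) :
    ∃ l, 1 ≤ l ∧ l ≤ J.n ∧ ∀ h < J.n, p h ≠ l := by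
  by_contra! hcon
  have hUu : U u := by
    by_contra hU
    exact H.mark u hu hU hst
  have hpu : p u = 0 := by
    by_contra h0
    obtain ⟨h1, h2, -⟩ := H.owner u hu (by omega)
    exact hU _ _ h2 h1 hUu
  have hsub : Finset.Icc 1 J.n ⊆ ((Finset.range J.n).erase u).image p := by
    intro l hl
    rw [Finset.mem_Icc] at hl
    obtain ⟨h, hh, rfl⟩ := hcon l hl.1 hl.2
    refine Finset.mem_image_of_mem p (Finset.mem_erase.2 ⟨?_, Finset.mem_range.2 hh⟩)
    rintro rfl
    omega
  have := (Finset.card_le_card hsub).trans Finset.card_image_le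
  rw [Finset.card_erase_of_mem (Finset.mem_range.2 hu)] at this
  simp only [Nat.card_Icc, Finset.card_range] at this
  omega

/-- The vertices sold at a price greater than `l`, together with their owners and `u`. -/
def InCrown (J : GraphInstance) (p m : ℕ → ℕ) (l u v : ℕ) : Prop :=
  v = u ∨ ∃ h < J.n, l < p h ∧ (v = h ∨ v = m h)

/-- `L` enumerates the vertices outside the crown. -/
structure Enumerates (J : GraphInstance) (D : ℕ → Prop) (r : ℕ) (L : ℕ → ℕ) : Prop where
  lt : ∀ a < r, L a < J.n
  notMem : ∀ a < r, ¬ D (L a)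
  inj : ∀ a < r, ∀ b < r, L a = L b → a = b
  surj : ∀ v < J.n, ¬ D v → ∃ a < r, L a = v

/-- The removal of a crown preserves the answer, if the parameter drops by the number of vertices
in the head of the crown. -/
theorem IsAuction.exists_reduced (F : Type*) [Field F] {U : ℕ → Prop} (H : J.IsAuction U st p m)
    (hU : ∀ u v, J.adj u v → U u → ¬ U v) {u l : ℕ} (hu : u < J.n) (hst : st u = 0)
    (hup : ∀ h, J.adj u h → J.n + 1 ≤ p h) (hl : l ≤ J.n) (hgap : ∀ h < J.n, p h ≠ l)
    {r : ℕ} {L : ℕ → ℕ} (hL : J.Enumerates (J.InCrown p m l u) r L) :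
    ∃ J' : GraphInstance, J'.n = r ∧ J'.k = J.k - {h ∈ Finset.range J.n | l < p h}.card ∧
      J'.n < J.n ∧ (∀ a < r, ∀ b < r, J'.adj a b ↔ J.adj (L a) (L b)) ∧
      (J ∈ dualMinrank F ↔ J' ∈ dualMinrank F) := by
  classical
  have hUu : U u := by
    by_contra hU
    exact H.mark u hu hU hst
  let f : Fin r → Fin J.n := fun a => ⟨L a, hL.lt a a.2⟩
  have hf : Function.Injective f := fun a b h => Fin.ext (hL.inj a a.2 b b.2 (Fin.mk.inj_iff.1 h))
  let Hd : Finset (Fin J.n) := {h | l < p h}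
  let I : Finset (Fin J.n) := {v | (v : ℕ) = u ∨ ∃ h < J.n, l < p h ∧ (v : ℕ) = m h}
  have hIU : ∀ v ∈ I, U v := by
    intro v hv
    rcases (Finset.mem_filter.1 hv).2 with h | ⟨h, hh, hlt, e⟩
    · rwa [h]
    · rw [e]
      exact (H.owner h hh (by omega)).1
  have hHU : ∀ h ∈ Hd, ¬ U h := by
    intro h hh
    obtain ⟨h1, h2, -⟩ := H.owner h h.2 (by have := (Finset.mem_filter.1 hh).2; omega)
    exact hU _ _ h2 h1
  have hnbr : ∀ v ∈ I, ∀ w, J.graph.Adj v w → w ∈ Hd := by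
    intro v hv w hvw
    rw [← J.adj_coe] at hvw
    refine Finset.mem_filter.2 ⟨Finset.mem_univ _, ?_⟩
    rcases (Finset.mem_filter.1 hv).2 with h | ⟨h, hh, hlt, e⟩
    · have := hup w (h ▸ hvw)
      omega
    · have h1 := H.cheap h hh (by omega) w (e ▸ hvw)
      have h2 := hgap w w.2
      omega
  have hcrown : ∀ v : Fin J.n, J.InCrown p m l u v ↔ v ∈ I ∨ v ∈ Hd := by
    intro v
    simp only [InCrown, I, Hd, Finset.mem_filter, Finset.mem_univ, true_and]
    constructor
    · rintro (h | ⟨h, hh, hlt, e | e⟩)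
      · exact Or.inl (Or.inl h)
      · exact Or.inr (e ▸ hlt)
      · exact Or.inl (Or.inr ⟨h, hh, hlt, e⟩)
    · rintro ((h | ⟨h, hh, hlt, e⟩) | h)
      · exact Or.inl h
      · exact Or.inr ⟨h, hh, hlt, Or.inr e⟩
      · exact Or.inr ⟨v, v.2, h, Or.inl rfl⟩
  have hrange : ∀ a, f a ∉ I ∧ f a ∉ Hd := by
    intro a
    have := (hcrown (f a)).not.1 (hL.notMem a a.2)
    tauto
  have hcov : ∀ v, v ∈ I ∨ v ∈ Hd ∨ v ∈ Set.range f := by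
    intro v
    by_cases hv : J.InCrown p m l u v
    · have := (hcrown v).1 hv
      tauto
    · obtain ⟨a, ha, e⟩ := hL.surj v v.2 hv
      exact Or.inr (Or.inr ⟨⟨a, ha⟩, Fin.ext e⟩)
  have hHown : ∀ h ∈ Hd, J.adj (m h) h := fun h hh =>
    (H.owner h h.2 (by have := (Finset.mem_filter.1 hh).2; omega)).2.1
  let g : Fin J.n → Fin J.n := fun h => if hm : m h < J.n then ⟨m h, hm⟩ else h
  have hg : ∀ h ∈ Hd, (g h : ℕ) = m h := by
    intro h hh
    simp only [g, dif_pos (hHown h hh).lt_left]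
  have hle := minrank_le_comap_add_card F J.graph f I Hd g hcov
    (fun h hh => Finset.mem_filter.2 ⟨Finset.mem_univ _, Or.inr ⟨h, h.2,
      (Finset.mem_filter.1 hh).2, hg h hh⟩⟩)
    (fun h hh => (J.adj_coe _ _).1 (by rw [hg h hh]; exact (hHown h hh).symm))
    (fun h hh h' hh' e => Fin.ext (H.inj h h.2 h' h'.2
      (by have := (Finset.mem_filter.1 hh).2; omega)
      (by have := (Finset.mem_filter.1 hh').2; omega) (by rw [← hg h hh, ← hg h' hh', e])))
  have hge := comap_add_card_le_minrank F J.graph f hf I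
    (fun v hv w hw h => hHU w (hnbr v hv w h) (hIU w hw)) (fun a => (hrange a).1)
    (fun v hv a h => (hrange a).2 (hnbr v hv _ h))
  have hcard : J.n = r + I.card + Hd.card := by
    have hIH : Disjoint I Hd := Finset.disjoint_left.2 fun v h h' => hHU v h' (hIU v h)
    have hd : Disjoint (Finset.univ.image f) (I ∪ Hd) := by
      refine Finset.disjoint_left.2 fun v h h' => ?_
      obtain ⟨a, -, rfl⟩ := Finset.mem_image.1 h
      have := hrange a
      have := Finset.mem_union.1 h'
      tauto
    have hall : Finset.univ.image f ∪ (I ∪ Hd) = Finset.univ := by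
      ext v
      have := hcov v
      simp only [Finset.mem_union, Finset.mem_image, Finset.mem_univ, true_and, iff_true]
      simp only [Set.mem_range] at this
      tauto
    have := congrArg Finset.card hall
    rw [Finset.card_union_of_disjoint hd, Finset.card_union_of_disjoint hIH,
      Finset.card_image_of_injective _ hf] at this
    simp only [Finset.card_univ, Fintype.card_fin] at this
    omega
  have hHcard : Hd.card = {h ∈ Finset.range J.n | l < p h}.card := by
    refine Finset.card_bij (fun h _ => (h : ℕ)) ?_ (fun _ _ _ _ h => Fin.ext h) ?_
    · intro h hh
      exact Finset.mem_filter.2 ⟨Finset.mem_range.2 h.2, (Finset.mem_filter.1 hh).2⟩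
    · intro h hh
      obtain ⟨h1, h2⟩ := Finset.mem_filter.1 hh
      exact ⟨⟨h, Finset.mem_range.1 h1⟩, Finset.mem_filter.2 ⟨Finset.mem_univ _, h2⟩, rfl⟩
  have hIpos : 0 < I.card :=
    Finset.card_pos.2 ⟨⟨u, hu⟩, Finset.mem_filter.2 ⟨Finset.mem_univ _, Or.inl rfl⟩⟩
  have hmr := minrank_le_card F (J.graph.comap f)
  rw [Fintype.card_fin] at hmr
  refine ⟨⟨r, J.graph.comap f, J.k - {h ∈ Finset.range J.n | l < p h}.card⟩, rfl, rfl, ?_, ?_, ?_⟩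
  · change r < J.n
    omega
  · intro a ha b hb
    exact ⟨fun ⟨_, _, h⟩ => ⟨_, _, h⟩, fun ⟨_, _, h⟩ => ⟨ha, hb, h⟩⟩
  · simp only [dualMinrank, Set.mem_ofPred_eq]
    rw [← hHcard]
    omega

end GraphInstance

namespace RAMProgram

/-- Set register `6` to a number between `1` and the number of vertices that is not a price. -/
def findGap : RAMProgram :=
  const 6 0 ;; forLoop 10 0 (const 5 0 ;; mov 7 10 ;; inc 7 ;;
    forLoop 12 0 (load 8 4 12 ;; sub 3 8 7 ;; sub 8 7 8 ;; add 8 8 3 ;; ite 8 skip (const 5 1)) ;;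
    ite 5 skip (mov 6 7))

/-- Mark in bank `6` the crown of the vertices sold at a price greater than register `6`, and
subtract the number of these vertices from register `1`. -/
def markCrown : RAMProgram :=
  forLoop 10 0 (const 5 0 ;; store 6 10 5) ;; const 5 1 ;; store 6 4 5 ;;
  forLoop 10 0 (load 5 4 10 ;; sub 5 5 6 ;; ite 5
    (const 5 1 ;; store 6 10 5 ;; load 8 5 10 ;; store 6 8 5 ;; sub 1 1 5) skip)

/-- Write to bank `0` the adjacency matrix of the graph induced by the vertices that are not marked
in bank `6`. -/
def compact : RAMProgram :=
  const 3 0 ;; forLoop 10 0 (load 5 6 10 ;; ite 5 skip (store 7 3 10 ;; inc 3)) ;;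
  const 4 0 ;; forLoop 10 3 (load 5 7 10 ;;
    forLoop 12 3 (load 6 7 12 ;; edge 7 5 6 ;; store 0 4 7 ;; inc 4)) ;;
  mov 0 3

variable {B : ℕ} {J : GraphInstance} {s : RAMState}

theorem wp_findGap (hB : J.n ≤ B) (h : s.HoldsGraph J)
    (hgap : ∃ l, 1 ≤ l ∧ l ≤ J.n ∧ ∀ h < J.n, s.mem 4 h ≠ l) :
    wp B findGap (fun s' => s'.HoldsGraph J ∧ s'.reg 1 = s.reg 1 ∧ s'.reg 4 = s.reg 4 ∧
      s'.mem = s.mem ∧ s'.reg 6 ≤ J.n ∧ ∀ h < J.n, s.mem 4 h ≠ s'.reg 6) s := by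
  refine wp_forLoop J.n (fun i s' => s'.HoldsGraph J ∧ s'.reg 1 = s.reg 1 ∧
    s'.reg 4 = s.reg 4 ∧ s'.mem = s.mem ∧ ((∃ l, 1 ≤ l ∧ l ≤ i ∧ ∀ h < J.n, s.mem 4 h ≠ l) →
      s'.reg 6 ≤ J.n ∧ ∀ h < J.n, s.mem 4 h ≠ s'.reg 6))
    (by simpa using h.reg_zero) hB (by simp) (by simp) ?_ ?_ ?_ ?_
  · rintro j s x v (rfl | rfl | rfl) h <;> simpa using h
  · refine ⟨by simpa using h, by simp, by simp, by simp, ?_⟩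
    rintro ⟨l, h1, h2, -⟩
    omega
  · rintro i s₁ hi hri hr0 ⟨g1, g2, g3, g4, g5⟩
    refine wp_seq (P := forLoop 12 0 _) (wp_forLoop J.n (fun j s' => s'.HoldsGraph J ∧
      s'.reg 1 = s.reg 1 ∧ s'.reg 4 = s.reg 4 ∧ s'.mem = s.mem ∧ s'.reg 6 = s₁.reg 6 ∧
      s'.reg 10 = i ∧ s'.reg 7 = i + 1 ∧ (s'.reg 5 = 0 ↔ ∀ h < j, s.mem 4 h ≠ i + 1))
      (by simpa using hr0) hB (by simp) (by simp) ?_ ?_ ?_ fun _ hs => hs) ?_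
    · rintro j s x v (rfl | rfl | rfl) h <;> simpa using h
    · simp [g1, g2, g3, g4, hri]
    · rintro j s₂ hj hrj hr0' ⟨f1, f2, f3, f4, f5, f6, f7, f8⟩
      simp only [wp, skip, RAMState.reg_setReg, RAMState.mem_setReg]
      refine ⟨fun hne => ?_, fun h0 => ?_⟩
      · simp [f7, f4, hrj] at hne
        simp [f1, f2, f3, f4, f5, f6, f7, f8, hrj, hr0']
        refine ⟨fun hh h hhj => ?_, fun hh h hhj => hh h (by omega)⟩
        rcases (show h < j ∨ h = j by omega) with e | rfl
        · exact hh h e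
        · omega
      · simp [f7, f4, hrj] at h0
        simp [f1, f2, f3, f4, f5, f6, f7, hrj, hr0']
        exact ⟨j, le_rfl, by omega⟩
    · rintro s₂ ⟨f1, f2, f3, f4, f5, f6, f7, f8⟩
      simp only [wp, skip, mov, RAMState.reg_setReg, RAMState.mem_setReg]
      refine ⟨fun hne => ?_, fun h0 => ?_⟩
      · simp [f1, f2, f3, f4, f5, f6, f1.reg_zero, -forall_exists_index]
        rintro ⟨l, h1, h2, h3⟩
        refine g5 ⟨l, h1, ?_, h3⟩
        have : l ≠ i + 1 := by
          rintro rfl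
          exact hne (f8.2 h3)
        omega
      · simp [f1, f2, f3, f4, f6, f7, f1.reg_zero, -forall_exists_index]
        exact fun _ => ⟨hi, f8.1 h0⟩
  · rintro s' ⟨g1, g2, g3, g4, g5⟩
    exact ⟨g1, g2, g3, g4, g5 hgap⟩

theorem wp_markCrown (hB : J.n ≤ B) (h : s.HoldsGraph J) :
    wp B markCrown (fun s' => s'.HoldsGraph J ∧
      s'.reg 1 = s.reg 1 - {h ∈ Finset.range J.n | s.reg 6 < s.mem 4 h}.card ∧
      ∀ v < J.n, s'.mem 6 v ≠ 0 ↔ J.InCrown (s.mem 4) (s.mem 5) (s.reg 6) (s.reg 4) v) s := by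
  refine wp_forLoop J.n (fun i s' => s'.HoldsGraph J ∧ s'.reg 1 = s.reg 1 ∧
    s'.reg 4 = s.reg 4 ∧ s'.reg 6 = s.reg 6 ∧ s'.mem 4 = s.mem 4 ∧ s'.mem 5 = s.mem 5 ∧
    ∀ v < i, s'.mem 6 v = 0) h.reg_zero hB (by simp) (by simp) ?_ ?_ ?_ ?_
  · rintro j s x v (rfl | rfl | rfl) h <;> simpa using h
  · simp [h]
  · rintro i s₁ hi hri hr0 ⟨g1, g2, g3, g4, g5, g6, g7⟩
    simp [g1, g2, g3, g4, g5, g6, hri, hr0]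
    intro v hv
    rw [Function.update_apply]
    split_ifs
    · rfl
    · exact g7 v (by omega)
  rintro s₁ ⟨g1, g2, g3, g4, g5, g6, g7⟩
  refine wp_forLoop J.n (fun i s' => s'.HoldsGraph J ∧
    s'.reg 1 = s.reg 1 - {h ∈ Finset.range i | s.reg 6 < s.mem 4 h}.card ∧
    s'.reg 6 = s.reg 6 ∧ s'.mem 4 = s.mem 4 ∧ s'.mem 5 = s.mem 5 ∧
    ∀ v < J.n, s'.mem 6 v ≠ 0 ↔
      v = s.reg 4 ∨ ∃ h < i, s.reg 6 < s.mem 4 h ∧ (v = h ∨ v = s.mem 5 h))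
    (by simpa using g1.reg_zero) hB (by simp) (by simp) ?_ ?_ ?_ ?_
  · rintro j s x v (rfl | rfl | rfl) h <;> simpa using h
  · simp [g1, g2, g3, g4, g5, g6, Function.update_apply]
    intro v hv
    simp [g7 v hv]
  · rintro i s₂ hi hri hr0 ⟨f1, f2, f3, f4, f5, f6⟩
    simp only [wp, skip, RAMState.reg_setReg, RAMState.mem_setReg]
    refine ⟨fun hne => ?_, fun h0 => ?_⟩
    · have hlt : s.reg 6 < s.mem 4 i := by
        simp [f4, hri, f3] at hne
        omega
      simp [f1, f2, f3, f4, f5, hri, hr0, Finset.range_add_one, Finset.filter_insert, hlt,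
        Nat.sub_sub, Function.update_apply]
      intro v hv
      have := f6 v hv
      rw [ne_eq] at this
      split_ifs with e1 e2
      · simp only [not_false_eq_true, true_iff]
        exact Or.inr ⟨i, by omega, hlt, Or.inr e1⟩
      · simp only [not_false_eq_true, true_iff]
        exact Or.inr ⟨i, by omega, hlt, Or.inl e2⟩
      · rw [this]
        refine or_congr_right ⟨fun ⟨h, a, b⟩ => ⟨h, by omega, b⟩, fun ⟨h, a, b, c⟩ => ?_⟩
        rcases (show h < i ∨ h = i by omega) with e | rfl
        · exact ⟨h, e, b, c⟩
        · tauto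
    · have hlt : ¬ s.reg 6 < s.mem 4 i := by
        simp [f4, hri, f3] at h0
        omega
      simp [f1, f2, f3, f4, f5, hri, hr0, Finset.range_add_one, Finset.filter_insert, hlt]
      intro v hv
      rw [← ne_eq, f6 v hv]
      refine or_congr_right ⟨fun ⟨h, a, b⟩ => ⟨h, by omega, b⟩, fun ⟨h, a, b, c⟩ => ?_⟩
      rcases (show h < i ∨ h = i by omega) with e | rfl
      · exact ⟨h, e, b, c⟩
      · exact absurd b hlt
  · rintro s' ⟨f1, f2, f3, f4, f5, f6⟩
    exact ⟨f1, f2, f6⟩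

open Classical in
theorem wp_compact (hB : J.n ≤ B) (h : s.HoldsRows J) :
    wp B compact (fun s' => ∃ r L, J.Enumerates (fun v => s.mem 6 v ≠ 0) r L ∧
      s'.reg 0 = r ∧ s'.reg 1 = s.reg 1 ∧ ∀ a < r, ∀ b < r,
        s'.mem 0 (a * r + b) = if J.adj (L a) (L b) then 1 else 0) s := by
  refine wp_forLoop J.n (fun i s' => s'.HoldsRows J ∧ s'.reg 1 = s.reg 1 ∧
    s'.mem 6 = s.mem 6 ∧ s'.reg 3 ≤ i ∧ (∀ a < s'.reg 3, s'.mem 7 a < i ∧ s.mem 6 (s'.mem 7 a) = 0) ∧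
    (∀ a < s'.reg 3, ∀ b < s'.reg 3, s'.mem 7 a = s'.mem 7 b → a = b) ∧
    ∀ v < i, s.mem 6 v = 0 → ∃ a < s'.reg 3, s'.mem 7 a = v)
    (by simpa using h.reg_zero) hB (by simp) (by simp) ?_ ?_ ?_ ?_
  · rintro j s x v (rfl | rfl | rfl) h <;> simpa using h
  · simp [h]
  · rintro i s₁ hi hri hr0 ⟨g1, g2, g3, g4, g5, g6, g7⟩
    simp only [wp, skip, inc, RAMState.reg_setReg, RAMState.mem_setReg]
    refine ⟨fun hne => ?_, fun h0 => ?_⟩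
    · simp [g3, hri] at hne
      simp [g1, g2, g3, hri, hr0]
      refine ⟨by omega, fun a ha => ⟨(g5 a ha).1.le, (g5 a ha).2⟩, g6, fun v hv h0 => ?_⟩
      refine g7 v ?_ h0
      have : v ≠ i := by rintro rfl; exact hne h0
      omega
    · simp [g3, hri] at h0
      simp [g1, g2, g3, hri, hr0]
      refine ⟨by omega, fun a ha => ?_, fun a ha b hb hab => ?_, fun v hv hv0 => ?_⟩
      · rw [Function.update_apply]
        split_ifs with e
        · exact ⟨le_rfl, h0⟩
        · have := g5 a (by omega)
          exact ⟨this.1.le, this.2⟩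
      · rw [Function.update_apply, Function.update_apply] at hab
        split_ifs at hab with e1 e2 e2
        · omega
        · have := g5 b (by omega)
          omega
        · have := g5 a (by omega)
          omega
        · exact g6 a (by omega) b (by omega) hab
      · rcases (show v < i ∨ v = i by omega) with e | rfl
        · obtain ⟨a, ha, rfl⟩ := g7 v e hv0
          exact ⟨a, by omega, by rw [Function.update_of_ne (by omega)]⟩
        · exact ⟨_, le_rfl, by simp⟩
  rintro s₁ ⟨g1, g2, g3, g4, g5, g6, g7⟩
  obtain ⟨r, hr⟩ : ∃ r, s₁.reg 3 = r := ⟨_, rfl⟩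
  obtain ⟨L, hL⟩ : ∃ L, s₁.mem 7 = L := ⟨_, rfl⟩
  rw [hr] at g4 g5 g6 g7
  rw [hL] at g5 g6 g7
  have hrB : r ≤ B := by omega
  change wp B (forLoop 10 3 _ ;; _) _ _
  refine wp_seq (wp_forLoop r (fun i s' => s'.HoldsRows J ∧ s'.reg 1 = s.reg 1 ∧ s'.reg 3 = r ∧
    s'.mem 7 = L ∧ s'.reg 4 = i * r ∧
    ∀ a < i, ∀ b < r, s'.mem 0 (a * r + b) = if J.adj (L a) (L b) then 1 else 0)
    (by simpa using hr) hrB (by simp) (by simp) ?_ ?_ ?_ fun _ hs => hs) ?_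
  · rintro j s x v (rfl | rfl | rfl) h <;> simpa using h
  · simp [g1, g2, hr, hL]
  · rintro i s₂ hi hri hr3 ⟨f1, f2, -, f4, f5, f6⟩
    refine wp_forLoop r (fun j s' => s'.HoldsRows J ∧ s'.reg 1 = s.reg 1 ∧ s'.reg 3 = r ∧
      s'.mem 7 = L ∧ s'.reg 4 = i * r + j ∧ s'.reg 5 = L i ∧ s'.reg 10 = i ∧
      (∀ b < j, s'.mem 0 (i * r + b) = if J.adj (L i) (L b) then 1 else 0) ∧
      ∀ a < i, ∀ b < r, s'.mem 0 (a * r + b) = if J.adj (L a) (L b) then 1 else 0)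
      (by simpa using hr3) hrB (by simp) (by simp) ?_ ?_ ?_ ?_
    · rintro j s x v (rfl | rfl | rfl) h <;> simpa using h
    · simp [f1, f2, hr3, f4, f5, hri]
      exact f6
    · rintro j s₃ hj hrj - ⟨e1, e2, e3, e4, e5, e6, e7, e8, e9⟩
      have hadj := e1.mem_adj (g5 i hi).1 (g5 j hj).1
      simp [e1, e2, e3, e4, e5, e6, e7, hrj, hadj, ← Nat.add_assoc]
      refine ⟨fun b hb => ?_, fun a ha b hb => ?_⟩
      · rcases eq_or_ne b j with rfl | e
        · rw [Function.update_self]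
        · rw [Function.update_of_ne (by omega)]
          exact e8 b (by omega)
      · have h1 : (a + 1) * r ≤ i * r := Nat.mul_le_mul_right _ ha
        rw [Nat.succ_mul] at h1
        rw [Function.update_of_ne (by omega)]
        exact e9 a ha b hb
    · rintro s₃ ⟨e1, e2, e3, e4, e5, e6, e7, e8, e9⟩
      refine ⟨e7, e3, e1, e2, e3, e4, by rw [e5, Nat.succ_mul], fun a ha b hb => ?_⟩
      rcases (show a < i ∨ a = i by omega) with e | rfl
      · exact e9 a e b hb
      · exact e8 b hb
  · rintro s₂ ⟨f1, f2, f3, f4, f5, f6⟩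
    refine ⟨r, L, ⟨fun a ha => (g5 a ha).1, fun a ha => not_not.2 (g5 a ha).2, g6,
      fun v hv h0 => g7 v hv (not_not.1 h0)⟩, by simp [f3], by simp [f2], fun a ha b hb => ?_⟩
    simpa using f6 a ha b hb

end RAMProgram

end Crown

/-! ### The kernelization algorithm -/

section Kernelization

open RAMProgram

namespace GraphInstance

variable {J : GraphInstance}

theorem minrank_add_card_le (F : Type*) [Field F] (J : GraphInstance) (S : Finset ℕ) (g : ℕ → ℕ)
    (hadj : ∀ v ∈ S, J.adj v (g v)) (hgS : ∀ v ∈ S, g v ∉ S) (hinj : Set.InjOn g S) :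
    minrank F J.graph + S.card ≤ J.n := by
  let T : Finset (Fin J.n) := {v | (v : ℕ) ∈ S}
  let f : Fin J.n → Fin J.n := fun v => if h : g v < J.n then ⟨g v, h⟩ else v
  have hT : ∀ v ∈ T, (v : ℕ) ∈ S := fun v hv => (Finset.mem_filter.1 hv).2
  have hf : ∀ v ∈ T, (f v : ℕ) = g v := by
    intro v hv
    simp only [f, dif_pos (hadj v (hT v hv)).lt_right]
  have hcard : T.card = S.card := by
    refine Finset.card_bij (fun v _ => (v : ℕ)) hT (fun _ _ _ _ h => Fin.ext h) ?_
    exact fun v hv => ⟨⟨v, (hadj v hv).lt_left⟩, Finset.mem_filter.2 ⟨Finset.mem_univ _, hv⟩, rfl⟩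
  have := minrank_add_card_le_of_matching F J.graph T f
    (fun v hv h => hgS v (hT v hv) (hf v hv ▸ hT _ h))
    (fun v hv => (J.adj_coe _ _).1 (by rw [hf v hv]; exact hadj v (hT v hv)))
    (fun v hv w hw e => Fin.ext (hinj (hT v hv) (hT w hw) (by rw [← hf v hv, ← hf w hw, e])))
  rwa [hcard, Fintype.card_fin] at this

/-- If all buyers are served, then the graph has a matching with at least a third of its vertices
as edges. -/
theorem IsAuction.mem_dualMinrank (F : Type*) [Field F] {st₀ st p m : ℕ → ℕ}
    (H : J.IsAuction (fun u => st₀ u = 0) st p m) (hM : J.IsMatched st₀)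
    (hU : ∀ u v, J.adj u v → st₀ u ≠ 0 ∨ st₀ v ≠ 0) (hst : ∀ u < J.n, st u ≠ 0)
    (hk : 3 * J.k ≤ J.n + 2) : J ∈ dualMinrank F := by
  obtain ⟨S, g, hS⟩ := hM
  have h1 := J.minrank_add_card_le F S g hS.adj hS.notMem hS.inj
  have hg : ∀ u, ∃ h, u < J.n → st₀ u = 0 → h < J.n ∧ 0 < p h ∧ m h = u := by
    intro u
    by_cases hu : u < J.n ∧ st₀ u = 0
    · obtain ⟨h, hh⟩ := H.sold u hu.1 hu.2 (hst u hu.1)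
      exact ⟨h, fun _ _ => hh⟩
    · exact ⟨0, fun a b => absurd ⟨a, b⟩ hu⟩
  choose f hf using hg
  have hT : ∀ u, u ∈ (Finset.range J.n).filter (fun u => st₀ u = 0) ↔ u < J.n ∧ st₀ u = 0 := by
    simp
  have hfa : ∀ u < J.n, st₀ u = 0 → J.adj u (f u) := by
    intro u hu h0
    obtain ⟨a, b, c⟩ := hf u hu h0
    have := (H.owner _ a b).2.1
    rwa [c] at this
  have h2 := J.minrank_add_card_le F ((Finset.range J.n).filter fun u => st₀ u = 0) f
    (fun u hu => hfa u ((hT u).1 hu).1 ((hT u).1 hu).2)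
    (fun u hu hu' => by
      rw [hT] at hu hu'
      exact (hU u (f u) (hfa u hu.1 hu.2)).elim (fun h => h hu.2) fun h => h hu'.2)
    (fun u hu v hv e => by
      obtain ⟨hu1, hu2⟩ := (hT u).1 hu
      obtain ⟨hv1, hv2⟩ := (hT v).1 hv
      rw [← (hf u hu1 hu2).2.2, ← (hf v hv1 hv2).2.2, e])
  have h3 : (Finset.range J.n).filter (fun u => ¬ st₀ u = 0) = S ∪ S.image g := by
    ext v
    rw [Finset.mem_filter, Finset.mem_range, Finset.mem_union]
    constructor
    · rintro ⟨hv, h0⟩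
      exact (hS.ne_zero_iff v hv).1 h0
    · intro h
      have hv : v < J.n := by
        rcases h with h | h
        · exact (hS.adj v h).lt_left
        · obtain ⟨w, hw, rfl⟩ := Finset.mem_image.1 h
          exact (hS.adj w hw).lt_right
      exact ⟨hv, (hS.ne_zero_iff v hv).2 h⟩
  have h4 := Finset.card_filter_add_card_filter_not (s := Finset.range J.n) fun u => st₀ u = 0
  have hd : Disjoint S (S.image g) := by
    refine Finset.disjoint_left.2 fun v hv h => ?_
    obtain ⟨w, hw, rfl⟩ := Finset.mem_image.1 h
    exact hS.notMem w hw hv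
  rw [h3, Finset.card_union_of_disjoint hd, Finset.card_image_of_injOn hS.inj,
    Finset.card_range] at h4
  simp only [dualMinrank, Set.mem_ofPred_eq]
  omega

end GraphInstance

namespace RAMProgram

/-- Remove crowns as long as they are found, and solve the instance if this leaves at least
`3 * k - 2` vertices. -/
def kernelize : RAMProgram :=
  const 2 1 ;;
  .while 2 (copyMatrix ;; maximalMatching ;; auction ;; sub 5 0 4 ;; ite 5
    (findGap ;; markCrown ;; compact ;; const 2 1) (const 2 0)) ;;
  add 5 1 1 ;; add 5 5 1 ;; const 6 2 ;; add 6 6 0 ;; sub 5 5 6 ;; ite 5 skip (const 0 0 ;; const 1 0)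

open Classical in
theorem wp_kernelize (F : Type*) [Field F] {B : ℕ} {I : GraphInstance} {s : RAMState}
    (hB : (I.n + 2) ^ 2 ≤ B) (h : s.Outputs I) :
    wp B kernelize (fun s' => ∃ J : GraphInstance, s'.Outputs J ∧
      (I ∈ dualMinrank F ↔ J ∈ dualMinrank F) ∧ J.k ≤ I.k ∧ J.n ≤ 3 * J.k - 3) s := by
  have hB' : I.n + 1 ≤ B := by nlinarith
  refine wp_seq (P := .while 2 _) (Q := fun s' => ∃ J : GraphInstance, s'.Outputs J ∧
    (I ∈ dualMinrank F ↔ J ∈ dualMinrank F) ∧ J.k ≤ I.k ∧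
    (3 * J.k ≤ J.n + 2 → J ∈ dualMinrank F)) ?_ ?_
  · refine ⟨fun m s' => ∃ J : GraphInstance, s'.Outputs J ∧
      (I ∈ dualMinrank F ↔ J ∈ dualMinrank F) ∧ J.k ≤ I.k ∧ J.n ≤ I.n ∧
      (s'.reg 2 ≠ 0 → m = J.n + 1) ∧
      (s'.reg 2 = 0 → 3 * J.k ≤ J.n + 2 → J ∈ dualMinrank F), ⟨I.n + 1, hB', I, ?_⟩, ?_, ?_⟩
    · rw [RAMState.outputs_iff] at h ⊢
      refine ⟨by simpa [RAMState.HoldsMatrix] using h, Iff.rfl, le_rfl, le_rfl, fun _ => rfl, ?_⟩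
      simp
    · rintro m s' ⟨J, h1, h2, h3, h4, h5, h6⟩ hx
      exact ⟨J, h1, h2, h3, h6 hx⟩
    · rintro m s₁ ⟨J, h1, h2, h3, h4, h5, -⟩ hx
      obtain rfl := h5 hx
      have hJB : (J.n + 2) ^ 2 ≤ B := (Nat.pow_le_pow_left (by omega) 2).trans hB
      have hJB' : J.n ≤ B := by omega
      refine wp_seq (wp_copyMatrix hJB' h1) ?_
      rintro s₂ ⟨a1, a2⟩
      refine wp_seq (wp_maximalMatching hJB' a1 a2) ?_
      rintro s₃ ⟨b1, b2, b3, b4⟩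
      refine wp_seq (wp_auction hJB b1) ?_
      rintro s₄ ⟨c1, c2, c3, c4⟩
      have hind : ∀ u v, J.adj u v → s₃.mem 3 u = 0 → ¬ s₃.mem 3 v = 0 := fun u v huv h0 =>
        (b4 u v huv).resolve_left (not_not.2 h0)
      refine ⟨fun hlt => ?_, fun hge => ?_⟩
      · simp only [RAMState.reg_setReg, if_true, c1.reg_zero] at hlt
        obtain ⟨d1, d2, d3⟩ := c4.resolve_left fun h => by omega
        refine wp_seq (wp_findGap hJB' (by simpa using c1)
          (by simpa using c3.exists_gap hind d1 d2)) ?_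
        rintro s₅ ⟨e1, e2, e3, e4, e5, e6⟩
        simp only [RAMState.reg_setReg, RAMState.mem_setReg, Nat.reduceEqDiff, if_false]
          at e2 e3 e4 e5 e6
        refine wp_seq (wp_markCrown hJB' e1) ?_
        rintro s₆ ⟨f1, f2, f3⟩
        refine wp_seq (wp_compact hJB' f1.1) ?_
        rintro s₇ ⟨r, L, g1, g2, g3, g4⟩
        rw [e4, e3] at f3
        rw [e4, e2, c2, b2] at f2
        have hL : J.Enumerates (J.InCrown (s₄.mem 4) (s₄.mem 5) (s₅.reg 6) (s₄.reg 4)) r L :=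
          ⟨g1.lt, fun a ha h => g1.notMem a ha ((f3 _ (g1.lt a ha)).2 h), g1.inj,
            fun v hv h => g1.surj v hv ((f3 v hv).not.2 h)⟩
        obtain ⟨J', k1, k2, k3, k4, k5⟩ := c3.exists_reduced F hind d1 d2 d3 e5 e6 hL
        refine ⟨J'.n + 1, by omega, J', ?_, h2.trans k5, by omega, by omega, fun _ => rfl, by simp⟩
        rw [RAMState.outputs_iff]
        refine ⟨by simp [g2, k1], by simp [g3, f2, k2], fun i hi j hj => ?_⟩
        rw [k1] at hi hj ⊢
        simp only [RAMState.mem_setReg, g4 i hi j hj, if_congr (k4 i hi j hj) rfl rfl]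
      · simp only [RAMState.reg_setReg, if_true, c1.reg_zero] at hge
        obtain ⟨d1, d2⟩ := c4.resolve_right fun h => by omega
        refine ⟨0, by omega, J, ?_, h2, h3, h4, by simp, fun _ => c3.mem_dualMinrank F b3 b4 d2⟩
        rw [RAMState.outputs_iff]
        exact ⟨by simp [c1.reg_zero], by simp [c2, b2],
          by simpa [RAMState.HoldsMatrix] using c1.2⟩
  · rintro s₁ ⟨J, h1, h2, h3, h4⟩
    rw [RAMState.outputs_iff] at h1
    obtain ⟨r0, r1, hM⟩ := h1
    refine ⟨fun hne => ⟨J, ?_, h2, h3, ?_⟩, fun h0 =>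
      ⟨⟨0, ⊥, 0⟩, ?_, ?_, Nat.zero_le _, Nat.zero_le _⟩⟩
    · rw [RAMState.outputs_iff]
      simpa [RAMState.HoldsMatrix, r0, r1] using hM
    · simp [r0, r1] at hne
      omega
    · simp [RAMState.outputs_iff, RAMState.HoldsMatrix]
    · simp [r0, r1] at h0
      have hJ := h4 (by omega)
      have := minrank_le_card F (⊥ : SimpleGraph (Fin 0))
      refine iff_of_true (h2.2 hJ) ?_
      simp only [dualMinrank, Set.mem_ofPred_eq]
      simpa using this

/-- The program `kernelize` computes a kernel in polynomial time. -/
theorem exists_outputs_kernelize (F : Type*) [Field F] (I : GraphInstance) :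
    ∃ J : GraphInstance, ((I ∈ dualMinrank F ↔ J ∈ dualMinrank F) ∧ J.k ≤ I.k ∧
      J.n ≤ 3 * J.k - 3) ∧ ∃ t s', t ≤ ((cost kernelize).comp ((Polynomial.X + 2) ^ 2)).eval I.size ∧
        kernelize.Runs (RAMState.init I) t s' ∧ s'.Outputs J := by
  have hB : (I.n + 2) ^ 2 ≤ (I.size + 2) ^ 2 := by
    refine Nat.pow_le_pow_left (Nat.add_le_add_right ?_ 2) 2
    exact (Nat.le_self_pow two_ne_zero I.n).trans (Nat.le_add_right _ _)
  obtain ⟨t, s', ht, hr, J, h1, h2⟩ :=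
    exists_runs_of_wp (wp_kernelize F hB (RAMState.outputs_init I))
  refine ⟨J, h2, t, s', ?_, hr, h1⟩
  simpa [Polynomial.eval_comp] using ht

end RAMProgram

end Kernelization

/-- For every field `F` there is a polynomial-time kernelization algorithm for the Dual Minrank
problem over `F` which, given `(G, k)`, returns an equivalent instance `(G', k')` where `k' ≤ k`
and `G'` has at most `max (3 k' - 3) 0` vertices. -/
theorem theorem1p3 (F : Type*) [Field F] :
    ∃ (P : RAMProgram) (f : GraphInstance → GraphInstance),
      IsKernelization (dualMinrank F) P f ∧
        ∀ I : GraphInstance,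
          (f I).k ≤ I.k ∧ ((f I).n : ℤ) ≤ max (3 * ((f I).k : ℤ) - 3) 0 := by
  choose f hf hrun using RAMProgram.exists_outputs_kernelize F
  refine ⟨RAMProgram.kernelize, f, ⟨⟨_, hrun⟩, ⟨fun k => (3 * k) * (3 * k) + k, ?_, fun I => ?_⟩,
    fun I => (hf I).1⟩, fun I => ⟨(hf I).2.1, ?_⟩⟩
  · have h3 : Primrec fun k : ℕ => 3 * k := Primrec.nat_mul.comp (Primrec.const 3) Primrec.id
    exact (Primrec.nat_add.comp (Primrec.nat_mul.comp h3 h3) Primrec.id).to_comp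
  · obtain ⟨-, h1, h2⟩ := hf I
    have h3 : (f I).n * (f I).n ≤ (3 * I.k) * (3 * I.k) := Nat.mul_le_mul (by omega) (by omega)
    have h4 : Nat.size (f I).k ≤ (f I).k := Nat.size_le.2 Nat.lt_two_pow_self
    simp only [GraphInstance.size, pow_two]
    omega
  · obtain ⟨-, h1, h2⟩ := hf I
    omega
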